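/- Links are unoriented links in $S^3$ up to isotopy. A $\pm 5$-move on a link replaces two parallel strands by the same two strands twisted around each other by five half-twists of the same sense (right-handed or left-handed), and two links are *5-move equivalent* if they are related by a finite sequence of $\pm5$-moves, their inverses, and isotopies. A *rational tangle* is a 2-tangle obtained from the tangle $[0]$ or $[\infty]$ by repeatedly adding a single crossing, of either sign, on the right or at the bottom; a *rational link* is the numerator closure of a rational tangle. The Kauffman polynomial $\Lambda_L(a,x)$ of unoriented link diagrams is the regular isotopy invariant given by: $\Lambda_{\bigcirc}=1$; a curl of sign $\pm1$ contributes the factor $a^{\pm1}$; and $\Lambda_{L_+}+\Lambda_{L_-}=x(\Lambda_{L_0}+\Lambda_{L_\infty})$. Then $F_L(a,x)=a^{-w(L)}\Lambda_L(a,x)$, where $w$ is the writhe. For $a=1$ we have $F_L(1,x)=\Lambda_L(1,x)$, which is an invariant of unoriented links. Put $F_L=F_L\bigl(1,2\cos\tfrac{2\pi}{5}\bigr)$; that is, $F$ is a real-valued invariant of links satisfying these rules with $a=1$, $x=2\cos\frac{2\pi}{5}$, and such an invariant exists. **Theorem 2.9.** (i) Every rational link is 5-move equivalent to exactly one of the following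 four links: the trivial knot $T_1$, the trivial link of two components $T_2$, the Hopf link $H$, and the figure-eight knot $4_1$. (ii) Two rational links $L$ and $L'$ are 5-move equivalent if and only if $F_L=F_{L'}$. Moreover $F_{T_1}=1$, $F_{T_2}=\sqrt5$, $F_H=-1$ and $F_{4_1}=-\sqrt5$. -/

import Mathlib

/-!
Unoriented links in the 3-sphere, given by diagrams modulo Reidemeister moves.

A diagram in the plane is put in general position with respect to the height function and cut into
horizontal layers, read from the bottom to the top. A layer consists of vertical strands and one
elementary piece: a minimum (`cup`), a maximum (`cap`), or a crossing. Diagrams up to planar isotopy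
and Reidemeister moves are words in such layers modulo the moves listed below.
-/

namespace KnotDiagram

/-- The elementary pieces: `cup` is a local minimum, `cap` is a local maximum, `cross true` is the
crossing of two strands going up in which the strand from the bottom left to the top right is
the over-strand, and `cross false` is the one in which it is the under-strand. -/
inductive Piece
  | cup
  | cap
  | cross (s : Bool)

/-- The number of end points of a piece at its bottom. -/
def Piece.dom : Piece → ℕ
  | cup => 0
  | cap => 2
  | cross _ => 2

/-- The number of end points of a piece at its top. -/
def Piece.cod : Piece → ℕ
  | cup => 2
  | cap => 0
  | cross _ => 2

/-- A layer: a piece together with the number of vertical strands to the left of it. (The number of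
strands to the right of it is determined by the number of strands that enter the layer.) -/
structure Layer where
  left : ℕ
  piece : Piece

/-- The layer with a minimum to the right of `l` vertical strands. -/
abbrev cup (l : ℕ) : Layer := ⟨l, .cup⟩

/-- The layer with a maximum that joins the strands number `l` and `l + 1` (counted from `0`). -/
abbrev cap (l : ℕ) : Layer := ⟨l, .cap⟩

/-- The layer in which the strands number `l` and `l + 1` (counted from `0`) cross. -/
abbrev cross (s : Bool) (l : ℕ) : Layer := ⟨l, .cross s⟩

/-- A word in layers, the first letter being the bottom layer. -/
abbrev Word := List Layer

/-- The word `w` is a tangle diagram with `m` end points at the bottom and `n` at the top: every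
layer finds the strands that it needs. -/
def IsTangle : ℕ → Word → ℕ → Prop
  | m, [], n => m = n
  | m, t :: w, n => t.left + t.piece.dom ≤ m ∧ IsTangle (m - t.piece.dom + t.piece.cod) w n

/-- A link diagram is a tangle diagram without end points. -/
structure LinkDiagram where
  word : Word
  closed : IsTangle 0 word 0

/-- The local moves that generate regular isotopy. -/
inductive RegularMove : Word → Word → Prop
  /-- Two pieces beside each other are moved past each other vertically. -/
  | exchange (p q : Piece) (l k : ℕ) :
      RegularMove [⟨l, p⟩, ⟨l + p.cod + k, q⟩] [⟨l + p.dom + k, q⟩, ⟨l, p⟩]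
  /-- A minimum cancels with a neighbouring maximum. -/
  | zigzag_left (l : ℕ) : RegularMove [cup (l + 1), cap l] []
  | zigzag_right (l : ℕ) : RegularMove [cup l, cap (l + 1)] []
  /-- A strand that passes over (or under) one leg of a maximum or minimum is slid to the other. -/
  | slide_cap (s : Bool) (l : ℕ) :
      RegularMove [cross s l, cap (l + 1)] [cross (!s) (l + 1), cap l]
  | slide_cup (s : Bool) (l : ℕ) :
      RegularMove [cup (l + 1), cross s l] [cup l, cross (!s) (l + 1)]
  /-- The second Reidemeister move. -/
  | reidemeister_two (s : Bool) (l : ℕ) : RegularMove [cross s l, cross (!s) l] []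
  /-- The third Reidemeister move. -/
  | reidemeister_three (s : Bool) (l : ℕ) :
      RegularMove [cross s l, cross s (l + 1), cross s l]
        [cross s (l + 1), cross s l, cross s (l + 1)]

/-- The first Reidemeister move: `CurlMove e r r'` says that `r'` arises from `r` by the removal
of a curl whose crossing has sign `e` (for either orientation of the strand; since one of the two
strands of `cross true l` goes up and the other one down, its sign in a curl is `-1`). -/
inductive CurlMove : ℤ → Word → Word → Prop
  | cup_true (l : ℕ) : CurlMove (-1) [cup l, cross true l] [cup l]
  | cup_false (l : ℕ) : CurlMove 1 [cup l, cross false l] [cup l]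
  | cap_true (l : ℕ) : CurlMove (-1) [cross true l, cap l] [cap l]
  | cap_false (l : ℕ) : CurlMove 1 [cross false l, cap l] [cap l]

/-- Two link diagrams differ by the replacement of `r` by `r'` in one place. -/
def Replace (r r' : Word) (D D' : LinkDiagram) : Prop :=
  ∃ u v : Word, D.word = u ++ r ++ v ∧ D'.word = u ++ r' ++ v

/-- Two link diagrams differ by one regular move or by the removal of one curl. -/
def IsotopyStep (D D' : LinkDiagram) : Prop :=
  (∃ r r', RegularMove r r' ∧ Replace r r' D D') ∨
    ∃ e r r', CurlMove e r r' ∧ Replace r r' D D'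

/-- Unoriented (unframed) links up to isotopy: link diagrams modulo the equivalence relation
generated by the isotopy steps. -/
def Link : Type := Quot IsotopyStep

/-- The link with a given diagram. -/
def LinkDiagram.toLink (D : LinkDiagram) : Link := Quot.mk _ D

/-- One `5`-move or `(-5)`-move: two parallel strands are replaced by a twisted pair of strands with
five half-twists of the same sense. -/
def FiveMove (L L' : Link) : Prop :=
  ∃ (D D' : LinkDiagram) (s : Bool) (l : ℕ), D.toLink = L ∧ D'.toLink = L' ∧
    Replace [] [cross s l, cross s l, cross s l, cross s l, cross s l] D D'

/-- `5`-move equivalence of links: the equivalence relation generated by `±5`-moves. -/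
def FiveMoveEquiv : Link → Link → Prop := Relation.EqvGen FiveMove

/-- Diagrams of rational `2`-tangles in Conway's standard form. All these words have two end points
at the bottom and two at the top. One starts with the tangle `[0]` (a maximum below a minimum) or
with the tangle `[∞]` (two vertical strands) and repeatedly adds one crossing on the right, by which
the two right end points are twisted, or one crossing at the bottom, by which the two lower
end points are twisted. -/
inductive IsRationalTangle : Word → Prop
  | zero : IsRationalTangle [cap 0, cup 0]
  | infty : IsRationalTangle []
  | right {T : Word} (s : Bool) :
      IsRationalTangle T → IsRationalTangle ([cup 1] ++ T ++ [cross s 2, cap 1])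
  | bottom {T : Word} (s : Bool) : IsRationalTangle T → IsRationalTangle ([cross s 0] ++ T)

/-- The numerator closure of a `2`-tangle: the two upper end points are joined, and so are the two
lower ones. -/
def numerator (T : Word) : Word := [cup 0] ++ T ++ [cap 0]

/-- A rational link is the numerator of a rational tangle. -/
def IsRationalLink (L : Link) : Prop :=
  ∃ (T : Word) (D : LinkDiagram), IsRationalTangle T ∧ D.word = numerator T ∧ D.toLink = L

/-- The diagram of the trivial knot without crossings. -/
def circle : LinkDiagram := ⟨[cup 0, cap 0], by simp [IsTangle, Piece.dom, Piece.cod]⟩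

/-- The trivial knot. -/
def trivialKnot : Link := circle.toLink

/-- The trivial link of two components. -/
def trivialLinkTwo : Link :=
  LinkDiagram.toLink
    ⟨[cup 0, cap 0, cup 0, cap 0], by simp [IsTangle, Piece.dom, Piece.cod]⟩

/-- The Hopf link, as the closure of the 2-braid `σ₁²`. -/
def hopfLink : Link :=
  LinkDiagram.toLink
    ⟨[cup 0, cup 1, cross true 0, cross true 0, cap 1, cap 0],
      by simp [IsTangle, Piece.dom, Piece.cod]⟩

/-- The figure-eight knot, as the closure of the 3-braid `(σ₁ σ₂⁻¹)²`. -/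
def figureEightKnot : Link :=
  LinkDiagram.toLink
    ⟨[cup 0, cup 1, cup 2, cross true 0, cross false 1, cross true 0, cross false 1,
      cap 2, cap 1, cap 0], by simp [IsTangle, Piece.dom, Piece.cod]⟩

/-- The recursive rules of the Kauffman polynomial `Λ(a, x)` of link diagrams, with variables `a`
(invertible) and `x` in a commutative ring `R`: it is an invariant of regular isotopy, it is `1` on
the circle, a curl of sign `e` contributes the factor `a ^ e`, and
`Λ(L₊) + Λ(L₋) = x (Λ(L₀) + Λ(L_∞))`. The Kauffman polynomial of an oriented diagram is
`F = a ^ (-w) Λ` where `w` is the writhe; for `a = 1` it is `Λ`. -/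
structure IsKauffman {R : Type*} [CommRing R] (a : Rˣ) (x : R) (Λ : LinkDiagram → R) : Prop where
  regular : ∀ {r r' : Word} {D D' : LinkDiagram}, RegularMove r r' → Replace r r' D D' → Λ D = Λ D'
  circle : Λ circle = 1
  curl : ∀ {e : ℤ} {r r' : Word} {D D' : LinkDiagram}, CurlMove e r r' → Replace r r' D D' →
    Λ D = ((a ^ e : Rˣ) : R) * Λ D'
  skein : ∀ (u v : Word) (l : ℕ) (Dpos Dneg Dzero Dinfty : LinkDiagram),
    Dpos.word = u ++ [cross true l] ++ v → Dneg.word = u ++ [cross false l] ++ v →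
    Dzero.word = u ++ v → Dinfty.word = u ++ [cap l, cup l] ++ v →
    Λ Dpos + Λ Dneg = x * (Λ Dzero + Λ Dinfty)

/-- The values of a Kauffman polynomial at other parameters (such as the values of the two-variable
polynomial at complex or real numbers) satisfy the rules with these parameters. -/
theorem IsKauffman.map {R S : Type*} [CommRing R] [CommRing S] {a : Rˣ} {x : R}
    {Λ : LinkDiagram → R} (h : IsKauffman a x Λ) (f : R →+* S) :
    IsKauffman (Units.map (f : R →* S) a) (f x) (fun D => f (Λ D)) where
  regular hm hr := by rw [h.regular hm hr]
  circle := by rw [h.circle, map_one]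
  curl hm hr := by
    rw [h.curl hm hr, map_mul, ← map_zpow]
    rfl
  skein u v l Dp Dn Dz Di hp hn hz hi := by
    rw [← map_add, h.skein u v l Dp Dn Dz Di hp hn hz hi, map_mul, map_add]

/-- `F` assigns to every unoriented link `L` the value `F_L(1, x)` of the Kauffman polynomial. -/
def IsKauffmanValueAtOne (x : ℝ) (F : Link → ℝ) : Prop :=
  IsKauffman (1 : ℝˣ) x (fun D => F D.toLink)

end KnotDiagram

namespace KnotDiagram

open Finset

/-! ### The Gaussian spin model over `ZMod 5` -/

/-! Upper bound. Bending up the lower ends of a rational tangle gives a plat: two nested or two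
parallel minima followed by crossings of strands 2, 3 (`inner`) and 3, 4 (`outer`). These twists
satisfy the braid relation of B₃, and 5-moves kill their fifth powers. Coset enumeration then leaves
at most twelve plats, modelled by the nonzero vectors of (ℤ/5)² up to sign, the vertices of the
icosahedron (`IsTwistAction.table`). Closing with two maxima turns an outer crossing into a curl
(`PlatClass.close_outer`), so the link depends only on the cycle of the outer twist. This rotation
of order five has two fixed vertices and two 5-cycles, whence four classes
(`IsTwistAction.four_values`).

Lower bound. Put x = 2cos(2π/5). At a = 1 the values on k half-twists obey a linear recurrence whose
characteristic roots are primitive fifth roots of unity, so F is unchanged by 5-moves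
(`eq_of_five_skein`, `IsKauffmanValueAtOne.fiveMove`). Skein relations inside the twelve-element
orbit give 1, √5, -1, -√5 (`IsKauffmanValueAtOne.values`), which are distinct.

Existence of F. Shade the regions of a diagram in checkerboard fashion, put spins in ℤ/5 on the
shaded regions and give a crossing the weight ζ^(±t²), where t is the difference of its two spins
and ζ = exp(2πi/5). The Gauss sum √5, completing the square and orthogonality of characters give the
Reidemeister moves. The skein rule holds because the nonzero squares mod 5 are exactly ±1
(`gaussInvariant_isKauffmanValueAtOne`). -/

theorem two_mul_cos_two_pi_div_five : 2 * Real.cos (2 * Real.pi / 5) = (√5 - 1) / 2 := by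
  have h : 2 * Real.pi / 5 = 2 * (Real.pi / 5) := by ring
  rw [h, Real.cos_two_mul, Real.cos_pi_div_five]
  have h5 : √5 ^ 2 = 5 := Real.sq_sqrt (by norm_num)
  linear_combination h5 / 4

/-- A state: the spins of the shaded regions along a horizontal line, from left to right. The
region between the strands number `2 * j` and `2 * j + 1` carries the spin number `j`. -/
abbrev Spins := ℕ → ZMod 5

/-- Insert the spin `t` at position `j`. -/
def Spins.insert (j : ℕ) (t : ZMod 5) (σ : Spins) : Spins := fun i =>
  if i < j then σ i else if i = j then t else σ (i - 1)

/-- Remove the spin at position `j`. -/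
def Spins.remove (j : ℕ) (σ : Spins) : Spins := fun i => if i < j then σ i else σ (i + 1)

/-- Replace the spin at position `j` by `t`. -/
def Spins.set (j : ℕ) (t : ZMod 5) (σ : Spins) : Spins := fun i => if i = j then t else σ i

/-- The sign of a crossing. -/
def crossSign (s : Bool) : ZMod 5 := if s then 1 else -1

theorem crossSign_not (s : Bool) : crossSign (!s) = -crossSign s := by
  cases s <;> simp [crossSign]

/-- The Gaussian Boltzmann weights. -/
noncomputable def weight (s : Bool) (t : ZMod 5) : ℂ := ZMod.stdAddChar (crossSign s * t ^ 2)

theorem weight_zero (s : Bool) : weight s 0 = 1 := by simp [weight]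

theorem weight_neg (s : Bool) (t : ZMod 5) : weight s (-t) = weight s t := by simp [weight]

theorem weight_sub_comm (s : Bool) (t u : ZMod 5) : weight s (t - u) = weight s (u - t) := by
  rw [← weight_neg, neg_sub]

theorem weight_mul_weight_not (s : Bool) (t : ZMod 5) : weight s t * weight (!s) t = 1 := by
  rw [weight, weight, ← AddChar.map_add_eq_mul, crossSign_not]
  simp

theorem stdAddChar_one_add_neg_one :
    (ZMod.stdAddChar (1 : ZMod 5) + ZMod.stdAddChar (-1 : ZMod 5) : ℂ) = (√5 - 1) / 2 := by
  have h1 := ZMod.stdAddChar_coe (N := 5) 1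
  have h2 := ZMod.stdAddChar_coe (N := 5) (-1)
  push_cast at h1 h2
  rw [h1, h2]
  have h := two_mul_cos_two_pi_div_five
  have h' := congrArg (fun r : ℝ => (r : ℂ)) h
  push_cast at h'
  rw [← h', Complex.two_cos]
  congr 2 <;> ring

/-- For `t ≠ 0` the square is `1` or `-1`, so the two exponents are `1` and `-1` in some order and
the sum does not depend on `t`. This is the source of the skein rule. -/
theorem weight_true_add_false (t : ZMod 5) :
    weight true t + weight false t = if t = 0 then 2 else ((√5 : ℂ) - 1) / 2 := by
  have key : ∀ t : ZMod 5, t = 0 ∨ (t ≠ 0 ∧ (t ^ 2 = 1 ∨ t ^ 2 = -1)) := by decide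
  rcases key t with rfl | ⟨h0, h | h⟩
  · simp [weight_zero]; norm_num
  · rw [if_neg h0, ← stdAddChar_one_add_neg_one]
    simp [weight, crossSign, h]
  · rw [if_neg h0, ← stdAddChar_one_add_neg_one]
    simp [weight, crossSign, h, add_comm]

theorem sqrt_five_mul_self : (√5 : ℂ) * √5 = 5 := by
  rw [← Complex.ofReal_mul, Real.mul_self_sqrt (by norm_num)]
  norm_num

theorem sqrt_five_ne_zero : (√5 : ℂ) ≠ 0 := by
  intro h
  have := sqrt_five_mul_self
  rw [h] at this
  norm_num at this

/-- The Gauss sum. -/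
theorem sum_weight (s : Bool) : ∑ t, weight s t = √5 := by
  have h1 := stdAddChar_one_add_neg_one
  have e : ∀ s, ∑ t, weight s t = 1 + 2 * (ZMod.stdAddChar (1 : ZMod 5) +
      ZMod.stdAddChar (-1 : ZMod 5)) := by
    intro s
    have : (univ : Finset (ZMod 5)) = {0, 1, 2, 3, 4} := by decide
    rw [this]
    have e1 : (1 : ZMod 5) ^ 2 = 1 := by decide
    have e2 : (2 : ZMod 5) ^ 2 = -1 := by decide
    have e3 : (3 : ZMod 5) ^ 2 = -1 := by decide
    have e4 : (4 : ZMod 5) ^ 2 = 1 := by decide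
    rw [sum_insert (by decide), sum_insert (by decide), sum_insert (by decide),
      sum_insert (by decide), sum_singleton, weight_zero]
    simp only [weight, e1, e2, e3, e4]
    cases s <;> simp only [crossSign, if_true, neg_mul, one_mul, neg_neg, Bool.false_eq_true,
      if_false] <;> ring
  rw [e, h1]
  ring

/-- The star-triangle relation. -/
theorem star_triangle (s : Bool) (a b u : ZMod 5) :
    (√5 : ℂ)⁻¹ * ∑ t, weight (!s) (t - a) * weight s (t - b) * weight (!s) (u - t) =
      weight s (a - b) * weight (!s) (u - a) * weight s (u - b) := by
  -- Completing the square in `t`: the exponent is a constant plus a single square centred at `a - b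
  -- + u`, which leaves a Gauss sum.
  have h : ∀ t, weight (!s) (t - a) * weight s (t - b) * weight (!s) (u - t) =
      weight s (a - b) * weight (!s) (u - a) * weight s (u - b) *
        weight (!s) (t - (a - b + u)) := by
    intro t
    simp only [weight, ← AddChar.map_add_eq_mul, crossSign_not]
    congr 1
    ring
  simp_rw [h]
  have h' : ∑ t, weight (!s) (t - (a - b + u)) = √5 := by
    rw [← sum_weight (!s)]
    exact (Equiv.subRight (a - b + u)).sum_comp (weight (!s))
  rw [← mul_sum, h']
  field_simp [sqrt_five_ne_zero]

/-- The transfer operator of a layer, acting on functions of the spins above it. -/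
noncomputable def transfer (t : Layer) (f : Spins → ℂ) (σ : Spins) : ℂ :=
  -- At an even position the shaded region `j` lies between the two strands: a minimum opens it, a
  -- maximum closes it, a crossing replaces it by a new one. At an odd position the regions `j` and
  -- `j + 1` lie on the two sides: a minimum splits one region into them, a maximum merges them. The
  -- powers of `√5` make zigzags cancel.
  let j := t.left / 2
  match t.piece with
  | .cup => if t.left % 2 = 0 then (√5 : ℂ)⁻¹ * ∑ t, f (σ.insert j t)
      else f (σ.insert (j + 1) (σ j))
  | .cap => if t.left % 2 = 0 then f (σ.remove j)
      else if σ j = σ (j + 1) then √5 * f (σ.remove (j + 1)) else 0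
  | .cross s => if t.left % 2 = 0 then (√5 : ℂ)⁻¹ * ∑ t, weight (!s) (t - σ j) * f (σ.set j t)
      else weight s (σ j - σ (j + 1)) * f σ

theorem even_div_two (j : ℕ) : 2 * j / 2 = j := by omega
theorem even_mod_two (j : ℕ) : 2 * j % 2 = 0 := by omega
theorem odd_div_two (j : ℕ) : (2 * j + 1) / 2 = j := by omega
theorem odd_mod_two (j : ℕ) : (2 * j + 1) % 2 ≠ 0 := by omega

section

variable (f : Spins → ℂ) (σ : Spins) (s : Bool) (j : ℕ)

theorem transfer_cup_even :
    transfer ⟨2 * j, .cup⟩ f σ = (√5 : ℂ)⁻¹ * ∑ t, f (σ.insert j t) := by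
  simp only [transfer, even_div_two, even_mod_two, if_true]

theorem transfer_cup_odd : transfer ⟨2 * j + 1, .cup⟩ f σ = f (σ.insert (j + 1) (σ j)) := by
  simp only [transfer, odd_div_two, odd_mod_two, if_false]

theorem transfer_cap_even : transfer ⟨2 * j, .cap⟩ f σ = f (σ.remove j) := by
  simp only [transfer, even_div_two, even_mod_two, if_true]

theorem transfer_cap_odd : transfer ⟨2 * j + 1, .cap⟩ f σ =
    if σ j = σ (j + 1) then √5 * f (σ.remove (j + 1)) else 0 := by
  simp only [transfer, odd_div_two, odd_mod_two, if_false]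

theorem transfer_cross_even : transfer ⟨2 * j, .cross s⟩ f σ =
    (√5 : ℂ)⁻¹ * ∑ t, weight (!s) (t - σ j) * f (σ.set j t) := by
  simp only [transfer, even_div_two, even_mod_two, if_true]

theorem transfer_cross_odd : transfer ⟨2 * j + 1, .cross s⟩ f σ =
    weight s (σ j - σ (j + 1)) * f σ := by
  simp only [transfer, odd_div_two, odd_mod_two, if_false]

end

theorem transfer_add (t : Layer) (f g : Spins → ℂ) :
    transfer t (f + g) = transfer t f + transfer t g := by
  funext σ
  rcases t with ⟨l, _ | _ | s⟩ <;>
    rcases Nat.even_or_odd' l with ⟨j, rfl | rfl⟩ <;>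
    simp only [transfer_cup_even, transfer_cup_odd, transfer_cap_even, transfer_cap_odd,
      transfer_cross_even, transfer_cross_odd, Pi.add_apply, mul_add, sum_add_distrib]
  split_ifs <;> simp

theorem transfer_smul (t : Layer) (c : ℂ) (f : Spins → ℂ) :
    transfer t (c • f) = c • transfer t f := by
  funext σ
  rcases t with ⟨l, _ | _ | s⟩ <;>
    rcases Nat.even_or_odd' l with ⟨j, rfl | rfl⟩ <;>
    simp only [transfer_cup_even, transfer_cup_odd, transfer_cap_even, transfer_cap_odd,
      transfer_cross_even, transfer_cross_odd, Pi.smul_apply, smul_eq_mul, mul_left_comm _ c,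
      ← mul_sum]
  split_ifs <;> simp

/-- The transfer operator of a word. -/
noncomputable def wordTransfer (w : Word) (f : Spins → ℂ) : Spins → ℂ := w.foldr transfer f

theorem wordTransfer_append (u v : Word) (f : Spins → ℂ) :
    wordTransfer (u ++ v) f = wordTransfer u (wordTransfer v f) := by
  simp [wordTransfer]

theorem wordTransfer_add (w : Word) (f g : Spins → ℂ) :
    wordTransfer w (f + g) = wordTransfer w f + wordTransfer w g := by
  induction w with
  | nil => rfl
  | cons t w ih => simp only [wordTransfer, List.foldr_cons] at ih ⊢; rw [ih, transfer_add]

theorem wordTransfer_smul (w : Word) (c : ℂ) (f : Spins → ℂ) :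
    wordTransfer w (c • f) = c • wordTransfer w f := by
  induction w with
  | nil => rfl
  | cons t w ih => simp only [wordTransfer, List.foldr_cons] at ih ⊢; rw [ih, transfer_smul]

/-! ### Index shifts for inserting, removing and replacing spins -/

namespace Spins

variable {i j n : ℕ} {t u : ZMod 5} {σ : Spins}

theorem insert_self : insert j t σ j = t := by simp [insert]

theorem insert_of_lt (h : i < j) : insert j t σ i = σ i := by simp [insert, h]

theorem insert_succ (h : j ≤ i) : insert j t σ (i + 1) = σ i := by grind [insert]

theorem insert_duplicate (h : j ≤ i) : insert (j + 1) (σ j) σ (i + 1) = σ i := by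
  grind [insert]

theorem remove_of_lt (h : i < j) : remove j σ i = σ i := by simp [remove, h]

theorem remove_of_le (h : j ≤ i) : remove j σ i = σ (i + 1) := by grind [remove]

theorem remove_of_eq (h : σ j = σ (j + 1)) (hi : j ≤ i) :
    remove (j + 1) σ i = σ (i + 1) := by
  grind [remove]

theorem set_self : set j t σ j = t := by simp [set]

theorem set_of_ne (h : i ≠ j) : set j t σ i = σ i := by simp [set, h]

theorem insert_insert (h : j ≤ n) :
    insert (n + 1) t (insert j u σ) = insert j u (insert n t σ) := by
  funext m; grind [insert]

theorem remove_insert (h : j ≤ n) :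
    remove (n + 1) (insert j u σ) = insert j u (remove n σ) := by
  funext m; grind [insert, remove]

theorem set_insert (h : j ≤ n) : set (n + 1) t (insert j u σ) = insert j u (set n t σ) := by
  funext m; grind [insert, set]

theorem insert_remove (h : j ≤ n) :
    insert n t (remove j σ) = remove j (insert (n + 1) t σ) := by
  funext m; grind [insert, remove]

theorem remove_remove (h : j ≤ n) : remove n (remove j σ) = remove j (remove (n + 1) σ) := by
  funext m; grind [remove]

theorem set_remove (h : j ≤ n) : set n t (remove j σ) = remove j (set (n + 1) t σ) := by
  funext m; grind [remove, set]

theorem insert_set (h : j < n) : insert n t (set j u σ) = set j u (insert n t σ) := by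
  funext m; grind [insert, set]

theorem remove_set (h : j < n) : remove n (set j u σ) = set j u (remove n σ) := by
  funext m; grind [remove, set]

theorem set_set_of_lt (h : j < n) : set n t (set j u σ) = set j u (set n t σ) := by
  funext m; grind [set]

theorem set_set : set j t (set j u σ) = set j t σ := by
  funext m; grind [set]

theorem set_eq_self : set j (σ j) σ = σ := by
  funext m; grind [set]

theorem remove_insert_self : remove j (insert j t σ) = σ := by
  funext m; grind [insert, remove]

theorem remove_insert_succ (h : t = σ j) : remove j (insert (j + 1) t σ) = σ := by
  funext m; grind [insert, remove]

theorem insert_remove_self : insert j t (remove j σ) = set j t σ := by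
  funext m; grind [insert, remove, set]

theorem set_insert_self : set j t (insert j u σ) = insert j t σ := by
  funext m; grind [insert, set]

theorem remove_succ_set : remove (j + 1) (set j (σ (j + 1)) σ) = remove j σ := by
  funext m; grind [remove, set]

theorem set_insert_succ : set j t (insert (j + 1) (σ j) σ) = insert j t σ := by
  funext m; grind [insert, set]

theorem insert_succ_remove (h : σ j = σ (j + 1)) :
    insert (j + 1) (σ j) (remove (j + 1) σ) = σ := by
  funext m; grind [insert, remove]

end Spins

/-! ### Isotopy invariance and the skein rule for transfer operators -/

theorem left_even_even (j i : ℕ) : 2 * j + 0 + 2 * i = 2 * (j + i) := by ring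
theorem left_even_odd (j i : ℕ) : 2 * j + 0 + (2 * i + 1) = 2 * (j + i) + 1 := by ring
theorem left_odd_even (j i : ℕ) : 2 * j + 1 + 0 + 2 * i = 2 * (j + i) + 1 := by ring
theorem left_odd_odd (j i : ℕ) : 2 * j + 1 + 0 + (2 * i + 1) = 2 * (j + i + 1) := by ring
theorem left_even_two_even (j i : ℕ) : 2 * j + 2 + 2 * i = 2 * (j + i + 1) := by ring
theorem left_even_two_odd (j i : ℕ) : 2 * j + 2 + (2 * i + 1) = 2 * (j + i + 1) + 1 := by ring
theorem left_odd_two_even (j i : ℕ) : 2 * j + 1 + 2 + 2 * i = 2 * (j + i + 1) + 1 := by ring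
theorem left_odd_two_odd (j i : ℕ) : 2 * j + 1 + 2 + (2 * i + 1) = 2 * (j + i + 1 + 1) := by ring

open Spins in
/-- Layers beside each other commute. -/
theorem transfer_exchange (p q : Piece) (l k : ℕ) (f : Spins → ℂ) :
    transfer ⟨l, p⟩ (transfer ⟨l + p.cod + k, q⟩ f) =
      transfer ⟨l + p.dom + k, q⟩ (transfer ⟨l, p⟩ f) := by
  funext σ
  rcases Nat.even_or_odd' l with ⟨j, rfl | rfl⟩ <;>
    rcases Nat.even_or_odd' k with ⟨i, rfl | rfl⟩ <;>
    rcases p with _ | _ | s <;> rcases q with _ | _ | s' <;>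
    simp only [Piece.dom, Piece.cod, left_even_even, left_even_odd, left_odd_even, left_odd_odd,
      left_even_two_even, left_even_two_odd, left_odd_two_even, left_odd_two_odd,
      transfer_cup_even, transfer_cup_odd, transfer_cap_even, transfer_cap_odd,
      transfer_cross_even, transfer_cross_odd, mul_sum]
  all_goals try rw [sum_comm]
  all_goals try simp (disch := omega) only [insert_of_lt, insert_succ, insert_duplicate,
    remove_of_lt, remove_of_le, set_of_ne, insert_insert, remove_insert, set_insert,
    insert_remove, remove_remove, set_remove, insert_set, remove_set, set_set_of_lt]
  all_goals try refine sum_congr rfl fun t _ => ?_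
  all_goals try refine sum_congr rfl fun u _ => ?_
  all_goals try ring1
  all_goals
    -- What remains are the equality tests of maxima at odd positions. For `i = 0` the right-hand
    -- piece touches the merged region, which carries the common value of both spins.
    have hr : σ j = σ (j + 1) → remove (j + 1) σ (j + i) = σ (j + i + 1) :=
      fun h => remove_of_eq h (by omega)
    by_cases h : σ j = σ (j + 1)
    on_goal 1 => try simp only [hr h]
    all_goals
      by_cases h₁ : σ (j + i) = σ (j + i + 1) <;>
      try simp (disch := exact sqrt_five_ne_zero) only [h, h₁, if_true, if_false, mul_zero,
        sum_const_zero, mul_inv_cancel_left₀, mul_left_comm _ (√5 : ℂ)]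
    all_goals
      by_cases h₂ : σ (j + i + 1) = σ (j + i + 1 + 1) <;>
      simp (disch := exact sqrt_five_ne_zero) only [h₂, if_true, if_false, mul_zero,
        sum_const_zero, mul_inv_cancel_left₀, mul_left_comm _ (√5 : ℂ)]

open Spins in
-- In the parity with a sum, the equality test of the odd maximum selects one spin, and `√5` cancels
-- `√5⁻¹`; in the other parity a spin is duplicated and removed again.
theorem transfer_zigzag_left (l : ℕ) (f : Spins → ℂ) :
    transfer (cup (l + 1)) (transfer (cap l) f) = f := by
  funext σ
  rcases Nat.even_or_odd' l with ⟨j, rfl | rfl⟩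
  · rw [transfer_cup_odd, transfer_cap_even, remove_insert_succ rfl]
  · rw [show 2 * j + 1 + 1 = 2 * (j + 1) by ring, transfer_cup_even]
    simp (disch := omega) only [transfer_cap_odd, insert_of_lt, insert_self, remove_insert_self]
    rw [sum_ite_eq univ (σ j) (fun _ => (√5 : ℂ) * f σ), if_pos (mem_univ _),
      inv_mul_cancel_left₀ sqrt_five_ne_zero]

open Spins in
theorem transfer_zigzag_right (l : ℕ) (f : Spins → ℂ) :
    transfer (cup l) (transfer (cap (l + 1)) f) = f := by
  funext σ
  rcases Nat.even_or_odd' l with ⟨j, rfl | rfl⟩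
  · rw [transfer_cup_even]
    simp (disch := omega) only [transfer_cap_odd, insert_succ, insert_self, remove_insert,
      insert_remove_self]
    rw [sum_ite_eq' univ (σ j), if_pos (mem_univ _), set_eq_self,
      inv_mul_cancel_left₀ sqrt_five_ne_zero]
  · rw [transfer_cup_odd, show 2 * j + 1 + 1 = 2 * (j + 1) by ring, transfer_cap_even,
      remove_insert_self]

open Spins in
theorem transfer_slide_cap (s : Bool) (l : ℕ) (f : Spins → ℂ) :
    transfer (cross s l) (transfer (cap (l + 1)) f) =
      transfer (cross (!s) (l + 1)) (transfer (cap l) f) := by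
  funext σ
  rcases Nat.even_or_odd' l with ⟨j, rfl | rfl⟩
  · simp (disch := omega) only [transfer_cross_even, transfer_cap_odd, transfer_cross_odd,
      transfer_cap_even, set_self, set_of_ne, mul_ite, mul_zero]
    rw [sum_ite_eq' univ (σ (j + 1)), if_pos (mem_univ _), remove_succ_set, weight_sub_comm,
      mul_left_comm (weight _ _), inv_mul_cancel_left₀ sqrt_five_ne_zero]
  · rw [show 2 * j + 1 + 1 = 2 * (j + 1) by ring]
    simp (disch := omega) only [transfer_cross_even, transfer_cap_odd, transfer_cross_odd,
      transfer_cap_even, set_self, set_of_ne, mul_ite, mul_zero, Bool.not_not]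
    rw [sum_ite_eq univ (σ j), if_pos (mem_univ _), mul_left_comm (weight _ _),
      inv_mul_cancel_left₀ sqrt_five_ne_zero]
    congr 2
    funext m
    grind [remove, Spins.set]

open Spins in
theorem transfer_slide_cup (s : Bool) (l : ℕ) (f : Spins → ℂ) :
    transfer (cup (l + 1)) (transfer (cross s l) f) =
      transfer (cup l) (transfer (cross (!s) (l + 1)) f) := by
  funext σ
  rcases Nat.even_or_odd' l with ⟨j, rfl | rfl⟩
  · simp (disch := omega) only [transfer_cup_odd, transfer_cross_even, transfer_cup_even,
      transfer_cross_odd, insert_of_lt, insert_self, insert_succ, set_insert_succ]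
  · rw [show 2 * j + 1 + 1 = 2 * (j + 1) by ring]
    simp (disch := omega) only [transfer_cup_odd, transfer_cross_even, transfer_cup_even,
      transfer_cross_odd, insert_of_lt, insert_self, set_insert_self, Bool.not_not]
    simp only [weight_sub_comm s (σ j)]

/-- The squares of `t` cancel and a linear character remains, so orthogonality applies. This is the
second Reidemeister move at even positions; at odd positions the weights are inverse to each other
pointwise. -/
theorem sum_weight_mul_weight (s : Bool) (a u : ZMod 5) :
    ∑ t, weight s (t - a) * weight (!s) (u - t) = if u = a then 5 else 0 := by
  have h : ∀ t, weight s (t - a) * weight (!s) (u - t) =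
      ZMod.stdAddChar (crossSign s * (a ^ 2 - u ^ 2)) *
        ZMod.stdAddChar (t * (2 * crossSign s * (u - a))) := by
    intro t
    simp only [weight, ← AddChar.map_add_eq_mul, crossSign_not]
    congr 1
    ring
  simp_rw [h]
  rw [← mul_sum, AddChar.sum_mulShift _ (ZMod.isPrimitive_stdAddChar 5)]
  have h2 : 2 * crossSign s * (u - a) = 0 ↔ u = a := by
    clear h
    revert u a
    cases s <;> simp only [crossSign] <;> decide
  by_cases hu : u = a
  · simp [hu]
  · simp [h2, hu]

open Spins in
theorem transfer_reidemeister_two (s : Bool) (l : ℕ) (f : Spins → ℂ) :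
    transfer (cross s l) (transfer (cross (!s) l) f) = f := by
  funext σ
  rcases Nat.even_or_odd' l with ⟨j, rfl | rfl⟩
  · simp only [transfer_cross_even, set_self, set_set, mul_sum]
    rw [sum_comm]
    have h : ∀ u, ∑ t, (√5 : ℂ)⁻¹ * (weight (!s) (t - σ j) *
        ((√5 : ℂ)⁻¹ * (weight (!!s) (u - t) * f (Spins.set j u σ)))) =
        if u = σ j then f σ else 0 := by
      intro u
      have := sum_weight_mul_weight (!s) (σ j) u
      calc _ = (√5 : ℂ)⁻¹ * (√5 : ℂ)⁻¹ * f (Spins.set j u σ) *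
          ∑ t, weight (!s) (t - σ j) * weight (!!s) (u - t) := by
            rw [mul_sum]; exact sum_congr rfl fun t _ => by ring
        _ = _ := by
          rw [this, ← mul_inv, sqrt_five_mul_self]
          split_ifs with hu
          · rw [hu, set_eq_self]; ring
          · simp
    rw [sum_congr rfl fun u _ => h u, sum_ite_eq' univ, if_pos (mem_univ _)]
  · rw [transfer_cross_odd, transfer_cross_odd, ← mul_assoc, weight_mul_weight_not, one_mul]

/-- The third Reidemeister move, in terms of the spin `t` at the position `j` and the spin `b` at a
neighbouring position. -/
theorem sum_sum_star_triangle (s : Bool) (a b : ZMod 5) (g : ZMod 5 → ℂ) :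
    (√5 : ℂ)⁻¹ * ∑ t, weight (!s) (t - a) *
      (weight s (t - b) * ((√5 : ℂ)⁻¹ * ∑ u, weight (!s) (u - t) * g u)) =
    weight s (a - b) * ((√5 : ℂ)⁻¹ * ∑ u, weight (!s) (u - a) * (weight s (u - b) * g u)) := by
  calc _ = (√5 : ℂ)⁻¹ * ∑ u, ((√5 : ℂ)⁻¹ *
        ∑ t, weight (!s) (t - a) * weight s (t - b) * weight (!s) (u - t)) * g u := by
        simp only [mul_sum, sum_mul]
        rw [sum_comm]
        exact sum_congr rfl fun u _ => sum_congr rfl fun t _ => by ring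
    _ = _ := by
      simp only [star_triangle]
      simp only [mul_sum]
      exact sum_congr rfl fun u _ => by ring

open Spins in
theorem transfer_reidemeister_three (s : Bool) (l : ℕ) (f : Spins → ℂ) :
    transfer (cross s l) (transfer (cross s (l + 1)) (transfer (cross s l) f)) =
      transfer (cross s (l + 1)) (transfer (cross s l) (transfer (cross s (l + 1)) f)) := by
  funext σ
  rcases Nat.even_or_odd' l with ⟨j, rfl | rfl⟩
  · simp (disch := omega) only [transfer_cross_even, transfer_cross_odd, set_self, set_set,
      set_of_ne]
    exact sum_sum_star_triangle s (σ j) (σ (j + 1)) _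
  · rw [show 2 * j + 1 + 1 = 2 * (j + 1) by ring]
    simp (disch := omega) only [transfer_cross_even, transfer_cross_odd, set_self, set_set,
      set_of_ne, weight_sub_comm s (σ j)]
    exact (sum_sum_star_triangle s (σ (j + 1)) (σ j) _).symm

theorem wordTransfer_regularMove {r r' : Word} (h : RegularMove r r') (f : Spins → ℂ) :
    wordTransfer r f = wordTransfer r' f := by
  cases h with
  | exchange p q l k => exact transfer_exchange p q l k f
  | zigzag_left l => exact transfer_zigzag_left l f
  | zigzag_right l => exact transfer_zigzag_right l f
  | slide_cap s l => exact transfer_slide_cap s l f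
  | slide_cup s l => exact transfer_slide_cup s l f
  | reidemeister_two s l => exact transfer_reidemeister_two s l f
  | reidemeister_three s l => exact transfer_reidemeister_three s l f

open Spins in
-- A curl costs a normalized Gauss sum at even positions and the weight of spin difference `0` at
-- odd ones. Both equal `1` for either sign, which is why the model has `a = 1`.
theorem transfer_cup_cross (s : Bool) (l : ℕ) (f : Spins → ℂ) :
    transfer (cup l) (transfer (cross s l) f) = transfer (cup l) f := by
  funext σ
  rcases Nat.even_or_odd' l with ⟨j, rfl | rfl⟩
  · simp only [transfer_cup_even, transfer_cross_even, insert_self, set_insert_self]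
    rw [← mul_sum, sum_comm]
    simp only [← sum_mul]
    have h : ∀ u, ∑ t, weight (!s) (u - t) = √5 := fun u => by
      rw [← sum_weight (!s)]
      exact (Equiv.subLeft u).sum_comp (weight (!s))
    simp only [h, ← mul_sum]
    rw [inv_mul_cancel_left₀ sqrt_five_ne_zero]
  · rw [transfer_cup_odd, transfer_cross_odd, transfer_cup_odd, insert_of_lt (by omega),
      insert_self, sub_self, weight_zero, one_mul]

open Spins in
theorem transfer_cross_cap (s : Bool) (l : ℕ) (f : Spins → ℂ) :
    transfer (cross s l) (transfer (cap l) f) = transfer (cap l) f := by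
  funext σ
  rcases Nat.even_or_odd' l with ⟨j, rfl | rfl⟩
  · simp only [transfer_cap_even, transfer_cross_even]
    have h : ∀ t, remove j (Spins.set j t σ) = remove j σ := fun t => by
      funext m; grind [remove, Spins.set]
    have h' : ∑ t, weight (!s) (t - σ j) = √5 := by
      rw [← sum_weight (!s)]
      exact (Equiv.subRight (σ j)).sum_comp (weight (!s))
    simp only [h, ← sum_mul]
    rw [h', inv_mul_cancel_left₀ sqrt_five_ne_zero]
  · rw [transfer_cross_odd, transfer_cap_odd]
    split_ifs with h
    · rw [h, sub_self, weight_zero, one_mul]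
    · rw [mul_zero]

theorem wordTransfer_curlMove {e : ℤ} {r r' : Word} (h : CurlMove e r r') (f : Spins → ℂ) :
    wordTransfer r f = wordTransfer r' f := by
  cases h with
  | cup_true l => exact transfer_cup_cross true l f
  | cup_false l => exact transfer_cup_cross false l f
  | cap_true l => exact transfer_cross_cap true l f
  | cap_false l => exact transfer_cross_cap false l f

theorem half_sqrt_five_sub_one_mul : ((√5 : ℂ) - 1) / 2 * (1 + √5) = 2 := by
  linear_combination sqrt_five_mul_self / 2

open Spins in
-- With x = (√5 - 1)/2 both parities rest on `weight true t + weight false t` = x(1 + √5 δ), where δ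
-- is `1` if `t = 0` and `0` otherwise. At odd positions the `1` is the vertical smoothing and √5 δ
-- the turn-back; at even positions they swap roles. The case `t = 0` is x(1 + √5) = 2.
theorem transfer_skein (l : ℕ) (f : Spins → ℂ) :
    transfer (cross true l) f + transfer (cross false l) f =
      (((√5 : ℂ) - 1) / 2) • (f + transfer (cap l) (transfer (cup l) f)) := by
  funext σ
  have h5 := half_sqrt_five_sub_one_mul
  rcases Nat.even_or_odd' l with ⟨j, rfl | rfl⟩
  · simp only [Pi.add_apply, Pi.smul_apply, smul_eq_mul, transfer_cross_even, transfer_cap_even,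
      transfer_cup_even, insert_remove_self, ← mul_add, ← sum_add_distrib, ← add_mul, Bool.not_true,
      Bool.not_false]
    simp only [add_comm (weight false _), weight_true_add_false, sub_eq_zero]
    have h : ∀ t, (if t = σ j then 2 else ((√5 : ℂ) - 1) / 2) * f (Spins.set j t σ) =
        (if t = σ j then ((√5 : ℂ) - 1) / 2 * √5 * f σ else 0) +
          ((√5 : ℂ) - 1) / 2 * f (Spins.set j t σ) := by
      intro t
      split_ifs with ht
      · rw [ht, set_eq_self]
        linear_combination -(f σ) * h5
      · rw [zero_add]
    simp only [h, sum_add_distrib]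
    rw [sum_ite_eq' univ, if_pos (mem_univ _), ← mul_sum, mul_add, mul_comm (_ / 2 : ℂ) (√5 : ℂ),
      mul_assoc, inv_mul_cancel_left₀ sqrt_five_ne_zero]
    ring
  · simp only [Pi.add_apply, Pi.smul_apply, smul_eq_mul, transfer_cross_odd, transfer_cap_odd,
      transfer_cup_odd, ← add_mul, weight_true_add_false, sub_eq_zero]
    split_ifs with h
    · have h' : Spins.insert (j + 1) (remove (j + 1) σ j) (remove (j + 1) σ) = σ := by
        rw [remove_of_lt (by omega), insert_succ_remove h]
      rw [h']
      linear_combination -(f σ) * h5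
    · rw [add_zero]

/-- The partition function of the spin model, normalized to be `1` on the circle. -/
noncomputable def partitionFunction (D : LinkDiagram) : ℝ :=
  ((√5 : ℂ)⁻¹ * wordTransfer D.word (fun _ => 1) 0).re

theorem partitionFunction_replace {r r' : Word} (h : ∀ f, wordTransfer r f = wordTransfer r' f)
    {D D' : LinkDiagram} (hD : Replace r r' D D') :
    partitionFunction D = partitionFunction D' := by
  obtain ⟨u, v, hu, hv⟩ := hD
  simp only [partitionFunction, hu, hv, wordTransfer_append, h]

/-- The partition function as an invariant of links. -/
noncomputable def gaussInvariant : Link → ℝ :=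
  Quot.lift partitionFunction (by
    rintro D D' (⟨r, r', h, hD⟩ | ⟨e, r, r', h, hD⟩)
    · exact partitionFunction_replace (wordTransfer_regularMove h) hD
    · exact partitionFunction_replace (wordTransfer_curlMove h) hD)

theorem gaussInvariant_isKauffmanValueAtOne :
    IsKauffmanValueAtOne (2 * Real.cos (2 * Real.pi / 5)) gaussInvariant where
  regular h hD := partitionFunction_replace (wordTransfer_regularMove h) hD
  circle := by
    have : wordTransfer [cup 0, cap 0] (fun _ => 1) 0 = √5 := by
      change transfer ⟨2 * 0, .cup⟩ (transfer ⟨2 * 0, .cap⟩ fun _ => 1) 0 = _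
      simp only [transfer_cup_even, transfer_cap_even, sum_const, card_univ, ZMod.card,
        nsmul_eq_mul, mul_one]
      rw [inv_mul_eq_iff_eq_mul₀ sqrt_five_ne_zero, sqrt_five_mul_self]
      norm_num
    change (_ * wordTransfer [cup 0, cap 0] (fun _ => 1) 0 : ℂ).re = 1
    rw [this, inv_mul_cancel₀ sqrt_five_ne_zero, Complex.one_re]
  curl h hD := by
    rw [one_zpow, Units.val_one, one_mul]
    exact partitionFunction_replace (wordTransfer_curlMove h) hD
  skein u v l Dp Dn Dz Di hp hn hz hi := by
    change partitionFunction Dp + partitionFunction Dn =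
      _ * (partitionFunction Dz + partitionFunction Di)
    have h := congrFun (congrArg (wordTransfer u)
      (transfer_skein l (wordTransfer v fun _ => 1))) 0
    rw [wordTransfer_add, wordTransfer_smul, wordTransfer_add] at h
    have hx : (((√5 : ℂ) - 1) / 2) = ((2 * Real.cos (2 * Real.pi / 5) : ℝ) : ℂ) := by
      rw [two_mul_cos_two_pi_div_five]
      push_cast
      rfl
    rw [hx] at h
    simp only [partitionFunction, hp, hn, hz, hi, wordTransfer_append, ← Complex.add_re, ← mul_add]
    rw [← Complex.re_ofReal_mul, mul_left_comm]
    exact congrArg (fun z : ℂ => ((√5 : ℂ)⁻¹ * z).re) h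

/-! ### Tangle diagrams up to isotopy and `5`-moves -/

/-- The local moves that generate isotopy and `5`-move equivalence. -/
inductive Move : Word → Word → Prop
  | regular {r r' : Word} : RegularMove r r' → Move r r'
  | curl {e : ℤ} {r r' : Word} : CurlMove e r r' → Move r r'
  | five (s : Bool) (l : ℕ) :
      Move [] [cross s l, cross s l, cross s l, cross s l, cross s l]

/-- Two tangle diagrams differ by one local move. -/
def Step (m n : ℕ) (w w' : Word) : Prop :=
  IsTangle m w n ∧ IsTangle m w' n ∧
    ∃ u v r r', Move r r' ∧ w = u ++ r ++ v ∧ w' = u ++ r' ++ v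

/-- Equivalence of tangle diagrams with `m` end points at the bottom and `n` at the top under
isotopy and `5`-moves. -/
def TangleEquiv (m n : ℕ) : Word → Word → Prop := Relation.EqvGen (Step m n)

theorem isTangle_append {m n : ℕ} {u v : Word} :
    IsTangle m (u ++ v) n ↔ ∃ k, IsTangle m u k ∧ IsTangle k v n := by
  induction u generalizing m with
  | nil => simp [IsTangle]
  | cons t u ih => simp [IsTangle, ih, and_assoc]

theorem IsTangle.append {m k n : ℕ} {u v : Word} (hu : IsTangle m u k) (hv : IsTangle k v n) :
    IsTangle m (u ++ v) n :=
  isTangle_append.2 ⟨k, hu, hv⟩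

theorem IsTangle.add_right {m n : ℕ} {w : Word} (h : IsTangle m w n) (k : ℕ) :
    IsTangle (m + k) w (n + k) := by
  induction w generalizing m with
  | nil => simp only [IsTangle] at h ⊢; omega
  | cons t w ih =>
    refine ⟨by have := h.1; omega, ?_⟩
    have := ih h.2
    have h1 := h.1
    rwa [show m - t.piece.dom + t.piece.cod + k = m + k - t.piece.dom + t.piece.cod by omega]
      at this

namespace TangleEquiv

variable {m n k k' : ℕ} {w w' w'' r r' u v : Word}

theorem refl (w : Word) : TangleEquiv m n w w := Relation.EqvGen.refl w

theorem symm (h : TangleEquiv m n w w') : TangleEquiv m n w' w := Relation.EqvGen.symm _ _ h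

theorem trans (h : TangleEquiv m n w w') (h' : TangleEquiv m n w' w'') : TangleEquiv m n w w'' :=
  Relation.EqvGen.trans _ _ _ h h'

instance : Trans (TangleEquiv m n) (TangleEquiv m n) (TangleEquiv m n) := ⟨trans⟩

theorem isTangle_iff (h : TangleEquiv m n w w') : IsTangle m w n ↔ IsTangle m w' n := by
  induction h with
  | rel x y h => simp [h.1, h.2.1]
  | refl x => rfl
  | symm x y _ ih => exact ih.symm
  | trans x y z _ _ ih ih₂ => exact ih.trans ih₂

/-- A local move, applied to the letters from number `i` on. -/
theorem move (i : ℕ) (h : Move r r')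
    (hw : w.take i ++ r ++ w.drop (i + r.length) = w := by rfl)
    (hw' : w.take i ++ r' ++ w.drop (i + r.length) = w' := by rfl)
    (ht : IsTangle m w n := by simp [IsTangle, Piece.dom, Piece.cod])
    (ht' : IsTangle m w' n := by simp [IsTangle, Piece.dom, Piece.cod]) : TangleEquiv m n w w' :=
  .rel _ _ ⟨ht, ht', _, _, _, _, h, hw.symm, hw'.symm⟩

/-- The inverse of a local move, applied to the letters from number `i` on. -/
theorem unmove (i : ℕ) (h : Move r r')
    (hw : w.take i ++ r' ++ w.drop (i + r'.length) = w := by rfl)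
    (hw' : w.take i ++ r ++ w.drop (i + r'.length) = w' := by rfl)
    (ht : IsTangle m w n := by simp [IsTangle, Piece.dom, Piece.cod])
    (ht' : IsTangle m w' n := by simp [IsTangle, Piece.dom, Piece.cod]) : TangleEquiv m n w w' :=
  symm (.rel _ _ ⟨ht', ht, _, _, _, _, h, hw'.symm, hw.symm⟩)

theorem congr (hu : IsTangle k u m) (h : TangleEquiv m n w w') (hv : IsTangle n v k') :
    TangleEquiv k k' (u ++ w ++ v) (u ++ w' ++ v) := by
  induction h with
  | rel x y h =>
    obtain ⟨hx, hy, u', v', r, r', hr, rfl, rfl⟩ := h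
    exact .rel _ _ ⟨(hu.append hx).append hv, (hu.append hy).append hv, u ++ u', v' ++ v, r, r', hr,
      by simp, by simp⟩
  | refl x => exact .refl _
  | symm x y _ ih => exact ih.symm
  | trans x y z _ _ ih ih₂ => exact ih.trans ih₂

theorem append_right (h : TangleEquiv m n w w') (hv : IsTangle n v k) :
    TangleEquiv m k (w ++ v) (w' ++ v) := by
  simpa using congr (u := []) (k := m) rfl h hv

theorem append_left (hu : IsTangle k u m) (h : TangleEquiv m n w w') :
    TangleEquiv k n (u ++ w) (u ++ w') := by
  simpa using congr (v := []) (k' := n) hu h rfl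

/-- A layer to the right of a tangle is moved past it. -/
theorem comm_layer {T : Word} (hT : IsTangle m T n) (q : Piece) (k e : ℕ) :
    TangleEquiv (m + k + q.dom + e) (n + k + q.cod + e) (T ++ [⟨n + k, q⟩]) (⟨m + k, q⟩ :: T) := by
  induction T generalizing m with
  | nil => obtain rfl : m = n := hT; exact refl _
  | cons t T ih =>
    obtain ⟨l, p⟩ := t
    obtain ⟨h1, h2⟩ := hT
    simp only at h1 h2
    -- `d` counts the strands of the tangle to the right of its first piece, so `d + k` strands
    -- separate this piece from `q`.
    obtain ⟨d, rfl⟩ := Nat.exists_eq_add_of_le h1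
    have e1 : l + p.dom + d - p.dom + p.cod = l + p.cod + d := by omega
    rw [e1] at h2
    have e2 : l + p.dom + d + k + q.dom + e - p.dom + p.cod = l + p.cod + d + k + q.dom + e := by
      omega
    have hp : IsTangle (l + p.dom + d + k + q.dom + e) [⟨l, p⟩]
        (l + p.cod + d + k + q.dom + e) := ⟨by simp only; omega, e2⟩
    have hq : ∀ a, IsTangle (a + d + k + q.dom + e) [⟨a + d + k, q⟩] (a + d + k + q.cod + e) :=
      fun a => ⟨by simp only; omega, by simp only [IsTangle]; omega⟩
    have hp' : IsTangle (l + p.dom + d + k + q.cod + e) [⟨l, p⟩]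
        (l + p.cod + d + k + q.cod + e) := ⟨by simp only; omega, by simp only [IsTangle]; omega⟩
    have hT : IsTangle (l + p.cod + d + k + q.cod + e) T (n + k + q.cod + e) := by
      have := h2.add_right (k + q.cod + e)
      simpa only [← add_assoc] using this
    refine (append_left hp (ih h2)).trans ?_
    refine append_right (w := [⟨l, p⟩, ⟨l + p.cod + d + k, q⟩])
      (w' := [⟨l + p.dom + d + k, q⟩, ⟨l, p⟩]) (n := l + p.cod + d + k + q.cod + e) ?_ hT
    have h := RegularMove.exchange p q l (d + k)
    simp only [← add_assoc] at h
    exact .rel _ _ ⟨hp.append (hq (l + p.cod)), (hq (l + p.dom)).append hp', [], [], _, _,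
      .regular h, rfl, rfl⟩

end TangleEquiv

theorem toLink_eq_of_isotopy {r r' : Word} {D D' : LinkDiagram} (hD : Replace r r' D D')
    (h : RegularMove r r' ∨ ∃ e, CurlMove e r r') : D.toLink = D'.toLink := by
  rcases h with h | ⟨e, h⟩
  · exact Quot.sound (Or.inl ⟨r, r', h, hD⟩)
  · exact Quot.sound (Or.inr ⟨e, r, r', h, hD⟩)

theorem TangleEquiv.fiveMoveEquiv {w w' : Word} (h : TangleEquiv 0 0 w w') (hw : IsTangle 0 w 0)
    (hw' : IsTangle 0 w' 0) :
    FiveMoveEquiv (LinkDiagram.toLink ⟨w, hw⟩) (LinkDiagram.toLink ⟨w', hw'⟩) := by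
  induction h with
  | rel x y h =>
    obtain ⟨-, -, u, v, r, r', h, hx, hy⟩ := h
    have hD : Replace r r' ⟨x, hw⟩ ⟨y, hw'⟩ := ⟨u, v, hx, hy⟩
    cases h with
    | regular h => rw [toLink_eq_of_isotopy hD (.inl h)]; exact .refl _
    | curl h => rw [toLink_eq_of_isotopy hD (.inr ⟨_, h⟩)]; exact .refl _
    | five s l => exact .rel _ _ ⟨_, _, s, l, rfl, rfl, hD⟩
  | refl x => exact .refl _
  | symm x y _ ih => exact .symm _ _ (ih hw' hw)
  | trans x y z hxy _ ih ih₂ =>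
    have hy := (isTangle_iff hxy).1 hw
    exact .trans _ _ _ (ih hw hy) (ih₂ hy hw')

/-! ### Rational tangles as plats -/

open TangleEquiv

theorem IsRationalTangle.isTangle {T : Word} (h : IsRationalTangle T) : IsTangle 2 T 2 := by
  induction h with
  | zero => simp [IsTangle, Piece.dom, Piece.cod]
  | infty => rfl
  | right s _ ih =>
    exact (IsTangle.append (k := 4) (by simp [IsTangle, Piece.dom, Piece.cod])
      (ih.add_right 2)).append (by simp [IsTangle, Piece.dom, Piece.cod])
  | bottom s _ ih => exact IsTangle.append (by simp [IsTangle, Piece.dom, Piece.cod]) ih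

/-- A crossing may be moved along a pair of nested minima. -/
theorem nested_cups_cross (s : Bool) :
    TangleEquiv 0 4 [cup 0, cup 1, cross s 0] [cup 0, cup 1, cross s 2] := by
  calc TangleEquiv 0 4 [cup 0, cup 1, cross s 0] [cup 0, cup 0, cross (!s) 1] :=
        move 1 (.regular (.slide_cup s 0))
    TangleEquiv 0 4 _ [cup 0, cup 2, cross (!s) 1] := unmove 0 (.regular (.exchange .cup .cup 0 0))
    TangleEquiv 0 4 _ [cup 0, cup 1, cross (!!s) 2] := move 1 (.regular (.slide_cup (!s) 1))
    _ = [cup 0, cup 1, cross s 2] := by rw [Bool.not_not]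

/-- The crossing at the bottom of a tangle whose lower end points are bent up. -/
theorem bend_bottom (s : Bool) {T : Word} (hT : IsTangle 2 T 2) :
    TangleEquiv 0 4 ([cup 0, cup 1] ++ ([cross s 0] ++ T)) ([cup 0, cup 1] ++ T ++ [cross s 2]) := by
  have h1 := append_right (nested_cups_cross s) (hT.add_right 2)
  have h2 := append_left (u := [cup 0, cup 1]) (k := 0)
    (by simp [IsTangle, Piece.dom, Piece.cod]) (comm_layer hT (.cross s) 0 0).symm
  simpa using h1.trans (by simpa [Piece.cod] using h2)

/-- The crossing on the right of a tangle whose lower end points are bent up. -/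
theorem bend_right (s : Bool) {T : Word} (hT : IsTangle 2 T 2) :
    TangleEquiv 0 4 ([cup 0, cup 1] ++ ([cup 1] ++ T ++ [cross s 2, cap 1]))
      ([cup 0, cup 1] ++ T ++ [cross (!s) 1]) := by
  have hc : ∀ s, IsTangle 6 [cross s 2, cap 1] 4 := by simp [IsTangle, Piece.dom, Piece.cod]
  have h1 : TangleEquiv 0 6 [cup 0, cup 1, cup 1] [cup 0, cup 1, cup 3] :=
    unmove 1 (.regular (.exchange .cup .cup 1 0))
  have h1' := append_right h1 ((hT.add_right 4).append (hc s))
  have h2 := congr (u := [cup 0, cup 1]) (k := 0)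
    (by simp [IsTangle, Piece.dom, Piece.cod]) (comm_layer hT .cup 1 1).symm (hc s)
  have h3 : TangleEquiv 4 4 [cup 3, cross s 2, cap 1] [cross (!s) 1] := by
    calc TangleEquiv 4 4 [cup 3, cross s 2, cap 1] [cup 2, cross (!s) 3, cap 1] :=
          move 0 (.regular (.slide_cup s 2))
      TangleEquiv 4 4 _ [cup 2, cap 1, cross (!s) 1] :=
          unmove 1 (.regular (.exchange .cap (.cross (!s)) 1 0))
      TangleEquiv 4 4 _ [cross (!s) 1] := move 0 (.regular (.zigzag_left 1))
  have h3' := append_left (IsTangle.append (u := [cup 0, cup 1]) (m := 0) (k := 4)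
    (by simp [IsTangle, Piece.dom, Piece.cod]) (hT.add_right 2)) h3
  simpa using h1'.trans ((by simpa using h2 : TangleEquiv 0 4 _ _).trans (by simpa using h3'))

/-- The numerator closure, in terms of the tangle whose lower end points are bent up. -/
theorem bend_numerator {T : Word} (hT : IsTangle 2 T 2) :
    TangleEquiv 0 0 (numerator T) ([cup 0, cup 1] ++ T ++ [cap 0, cap 0]) := by
  -- A zigzag turns the closing minimum into nested minima and a maximum on the right; the maximum
  -- is then lifted past `T`.
  have h1 : TangleEquiv 0 2 [cup 0] [cup 0, cup 1, cap 2] :=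
    unmove 1 (.regular (.zigzag_right 1))
  have h1' := append_right h1 (hT.append (v := [cap 0]) (n := 0)
    (by simp [IsTangle, Piece.dom, Piece.cod]))
  have h2 := congr (u := [cup 0, cup 1]) (k := 0) (v := [cap 0]) (k' := 0)
    (by simp [IsTangle, Piece.dom, Piece.cod]) (comm_layer hT .cap 0 0).symm
    (by simp [IsTangle, Piece.dom, Piece.cod])
  have h3 : TangleEquiv 4 0 [cap 2, cap 0] [cap 0, cap 0] :=
    unmove 0 (.regular (.exchange .cap .cap 0 0))
  have h3' := append_left (IsTangle.append (u := [cup 0, cup 1]) (m := 0) (k := 4)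
    (by simp [IsTangle, Piece.dom, Piece.cod]) (hT.add_right 2)) h3
  simpa [numerator] using
    h1'.trans ((by simpa using h2 : TangleEquiv 0 0 _ _).trans (by simpa using h3'))

/-- The Hopf link as a plat. -/
theorem hopf_plat : TangleEquiv 0 0
    [cup 0, cup 1, cross true 0, cross true 0, cap 1, cap 0]
    [cup 0, cup 2, cross false 1, cross false 1, cap 0, cap 0] := by
  calc TangleEquiv 0 0 _ [cup 0, cup 0, cross false 1, cross true 0, cap 1, cap 0] :=
        move 1 (.regular (.slide_cup true 0))
    TangleEquiv 0 0 _ [cup 0, cup 0, cross false 1, cross false 1, cap 0, cap 0] :=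
        move 3 (.regular (.slide_cap true 0))
    TangleEquiv 0 0 _ [cup 0, cup 2, cross false 1, cross false 1, cap 0, cap 0] :=
        unmove 0 (.regular (.exchange .cup .cup 0 0))

theorem nested_cups_cross_shifted (s : Bool) :
    TangleEquiv 2 6 [cup 1, cup 2, cross s 1] [cup 1, cup 2, cross s 3] := by
  calc TangleEquiv 2 6 [cup 1, cup 2, cross s 1] [cup 1, cup 1, cross (!s) 2] :=
        move 1 (.regular (.slide_cup s 1))
    TangleEquiv 2 6 _ [cup 1, cup 3, cross (!s) 2] := unmove 0 (.regular (.exchange .cup .cup 1 0))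
    TangleEquiv 2 6 _ [cup 1, cup 2, cross (!!s) 3] := move 1 (.regular (.slide_cup (!s) 2))
    _ = [cup 1, cup 2, cross s 3] := by rw [Bool.not_not]

/-- A clasp as a tangle between nested minima. -/
theorem clasp_nested : TangleEquiv 2 6 [cup 1, cup 1, cross true 2, cross true 2]
    [cup 1, cup 2, cross false 3, cross true 2] := by
  calc TangleEquiv 2 6 _ [cup 1, cup 3, cross true 2, cross true 2] :=
        unmove 0 (.regular (.exchange .cup .cup 1 0))
    TangleEquiv 2 6 _ [cup 1, cup 2, cross false 3, cross true 2] :=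
        move 1 (.regular (.slide_cup true 2))

/-- A positive crossing is flyped from one side of a clasp to the other. -/
theorem flype_true : TangleEquiv 2 6 [cup 1, cup 1, cross true 2, cross true 2, cross true 3]
    [cup 1, cup 1, cross true 2, cross true 2, cross true 1] := by
  -- With the crossing on either side, an inserted cancelling pair permits a third Reidemeister
  -- move, which exposes a curl on the inner minimum. The two reduced words differ by sliding a
  -- crossing along the nested minima.
  have h3 : TangleEquiv 2 6 [cup 1, cup 2, cross false 3, cross true 2, cross true 3]
      [cup 1, cup 2, cross true 3, cross false 2] := by
    calc TangleEquiv 2 6 _ [cup 1, cup 2, cross false 3, cross true 2, cross true 3, cross true 2,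
          cross false 2] := unmove 5 (.regular (.reidemeister_two true 2))
      TangleEquiv 2 6 _ [cup 1, cup 2, cross false 3, cross true 3, cross true 2, cross true 3,
          cross false 2] := move 3 (.regular (.reidemeister_three true 2))
      TangleEquiv 2 6 _ [cup 1, cup 2, cross true 2, cross true 3, cross false 2] :=
          move 2 (.regular (.reidemeister_two false 3))
      TangleEquiv 2 6 _ [cup 1, cup 2, cross true 3, cross false 2] := move 1 (.curl (.cup_true 2))
  have h1 : TangleEquiv 2 6 [cup 1, cup 2, cross false 1, cross true 2, cross true 1]
      [cup 1, cup 2, cross true 1, cross false 2] := by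
    calc TangleEquiv 2 6 _ [cup 1, cup 2, cross false 1, cross true 2, cross true 1, cross true 2,
          cross false 2] := unmove 5 (.regular (.reidemeister_two true 2))
      TangleEquiv 2 6 _ [cup 1, cup 2, cross false 1, cross true 1, cross true 2, cross true 1,
          cross false 2] := unmove 3 (.regular (.reidemeister_three true 1))
      TangleEquiv 2 6 _ [cup 1, cup 2, cross true 2, cross true 1, cross false 2] :=
          move 2 (.regular (.reidemeister_two false 1))
      TangleEquiv 2 6 _ [cup 1, cup 2, cross true 1, cross false 2] := move 1 (.curl (.cup_true 2))
  have hv' : IsTangle 6 [cross true 2, cross true 1] 6 := by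
    simp [IsTangle, Piece.dom, Piece.cod]
  calc TangleEquiv 2 6 _ [cup 1, cup 2, cross false 3, cross true 2, cross true 3] :=
        append_right clasp_nested (by simp [IsTangle, Piece.dom, Piece.cod])
    TangleEquiv 2 6 _ [cup 1, cup 2, cross true 3, cross false 2] := h3
    TangleEquiv 2 6 _ [cup 1, cup 2, cross true 1, cross false 2] :=
        append_right (nested_cups_cross_shifted true).symm (by simp [IsTangle, Piece.dom, Piece.cod])
    TangleEquiv 2 6 _ [cup 1, cup 2, cross false 1, cross true 2, cross true 1] := h1.symm
    TangleEquiv 2 6 _ [cup 1, cup 2, cross false 3, cross true 2, cross true 1] :=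
        append_right (nested_cups_cross_shifted false) hv'
    TangleEquiv 2 6 _ [cup 1, cup 1, cross true 2, cross true 2, cross true 1] :=
        append_right clasp_nested.symm (by simp [IsTangle, Piece.dom, Piece.cod])

/-- A negative crossing is flyped from one side of a clasp to the other. -/
theorem flype_false : TangleEquiv 2 6 [cup 1, cup 1, cross true 2, cross true 2, cross false 3]
    [cup 1, cup 1, cross true 2, cross true 2, cross false 1] := by
  have hv : IsTangle 6 [cross false 1, cross false 3] 6 := by
    simp [IsTangle, Piece.dom, Piece.cod]
  calc TangleEquiv 2 6 _ [cup 1, cup 1, cross true 2, cross true 2, cross true 1, cross false 1,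
        cross false 3] := unmove 4 (.regular (.reidemeister_two true 1))
    TangleEquiv 2 6 _ [cup 1, cup 1, cross true 2, cross true 2, cross true 3, cross false 1,
        cross false 3] := append_right flype_true.symm hv
    TangleEquiv 2 6 _ [cup 1, cup 1, cross true 2, cross true 2, cross true 3, cross false 3,
        cross false 1] := move 5 (.regular (.exchange (.cross false) (.cross false) 1 0))
    TangleEquiv 2 6 _ [cup 1, cup 1, cross true 2, cross true 2, cross false 1] :=
        move 4 (.regular (.reidemeister_two true 3))

/-- The figure-eight knot as a plat. -/
theorem figureEight_plat : TangleEquiv 0 0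
    [cup 0, cup 1, cup 2, cross true 0, cross false 1, cross true 0, cross false 1,
      cap 2, cap 1, cap 0]
    [cup 0, cup 1, cross true 2, cross true 2, cross false 1, cross false 1, cap 0, cap 0] := by
  calc TangleEquiv 0 0 _ [cup 0, cup 1, cup 2, cross true 0, cross false 1, cross true 0,
        cross true 2, cap 1, cap 1, cap 0] := move 6 (.regular (.slide_cap false 1))
    TangleEquiv 0 0 _ [cup 0, cup 1, cross true 0, cup 2, cross false 1, cross true 0,
        cross true 2, cap 1, cap 1, cap 0] :=
        unmove 2 (.regular (.exchange (.cross true) .cup 0 0))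
    TangleEquiv 0 0 _ [cup 0, cup 1, cross true 2, cup 2, cross false 1, cross true 0,
        cross true 2, cap 1, cap 1, cap 0] :=
        append_right (nested_cups_cross true) (by simp [IsTangle, Piece.dom, Piece.cod])
    TangleEquiv 0 0 _ [cup 0, cup 1, cup 2, cross true 4, cross false 1, cross true 0,
        cross true 2, cap 1, cap 1, cap 0] :=
        unmove 2 (.regular (.exchange .cup (.cross true) 2 0))
    TangleEquiv 0 0 _ [cup 0, cup 1, cup 2, cross false 1, cross true 4, cross true 0,
        cross true 2, cap 1, cap 1, cap 0] :=
        unmove 3 (.regular (.exchange (.cross false) (.cross true) 1 1))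
    TangleEquiv 0 0 _ [cup 0, cup 1, cup 2, cross false 1, cross true 4, cross true 2,
        cross true 0, cap 1, cap 1, cap 0] :=
        move 5 (.regular (.exchange (.cross true) (.cross true) 0 0))
    TangleEquiv 0 0 _ [cup 0, cup 1, cup 2, cross false 1, cross true 2, cross true 4,
        cross true 0, cap 1, cap 1, cap 0] :=
        unmove 4 (.regular (.exchange (.cross true) (.cross true) 2 0))
    TangleEquiv 0 0 _ [cup 0, cup 1, cup 1, cross true 2, cross true 2, cross true 4,
        cross true 0, cap 1, cap 1, cap 0] := move 2 (.regular (.slide_cup false 1))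
    TangleEquiv 0 0 _ [cup 0, cup 1, cup 1, cross true 2, cross true 2, cross true 4,
        cross false 1, cap 0, cap 1, cap 0] := move 6 (.regular (.slide_cap true 0))
    TangleEquiv 0 0 _ [cup 0, cup 1, cup 1, cross true 2, cross true 2, cross true 4,
        cross false 1, cap 3, cap 0, cap 0] := move 7 (.regular (.exchange .cap .cap 0 1))
    TangleEquiv 0 0 _ [cup 0, cup 1, cup 1, cross true 2, cross true 2, cross true 4,
        cap 3, cross false 1, cap 0, cap 0] :=
        move 6 (.regular (.exchange (.cross false) .cap 1 0))
    TangleEquiv 0 0 _ [cup 0, cup 1, cup 1, cross true 2, cross true 2, cross false 3,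
        cap 4, cross false 1, cap 0, cap 0] := unmove 5 (.regular (.slide_cap false 3))
    -- The crossing between strands 3 and 4 keeps `cap 4` from cancelling a minimum. The flype
    -- carries it to the other side of the clasp, after which the zigzag can be straightened.
    TangleEquiv 0 0 _ [cup 0, cup 1, cup 1, cross true 2, cross true 2, cross false 1,
        cap 4, cross false 1, cap 0, cap 0] :=
        congr (u := [cup 0]) (v := [cap 4, cross false 1, cap 0, cap 0])
          (by simp [IsTangle, Piece.dom, Piece.cod]) flype_false
          (by simp [IsTangle, Piece.dom, Piece.cod])
    TangleEquiv 0 0 _ [cup 0, cup 1, cup 1, cross true 2, cross true 2, cap 4,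
        cross false 1, cross false 1, cap 0, cap 0] :=
        move 5 (.regular (.exchange (.cross false) .cap 1 1))
    TangleEquiv 0 0 _ [cup 0, cup 1, cup 1, cross true 2, cap 4, cross true 2,
        cross false 1, cross false 1, cap 0, cap 0] :=
        move 4 (.regular (.exchange (.cross true) .cap 2 0))
    TangleEquiv 0 0 _ [cup 0, cup 1, cup 1, cap 4, cross true 2, cross true 2,
        cross false 1, cross false 1, cap 0, cap 0] :=
        move 3 (.regular (.exchange (.cross true) .cap 2 0))
    TangleEquiv 0 0 _ [cup 0, cup 1, cup 3, cap 4, cross true 2, cross true 2,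
        cross false 1, cross false 1, cap 0, cap 0] :=
        unmove 1 (.regular (.exchange .cup .cup 1 0))
    TangleEquiv 0 0 _ [cup 0, cup 1, cross true 2, cross true 2,
        cross false 1, cross false 1, cap 0, cap 0] := move 2 (.regular (.zigzag_right 3))

/-! ### The icosahedral orbit -/

/-- The orbit of two elements under two maps. -/
inductive InOrbit {Q : Type*} (a b : Q → Q) (A C : Q) : Q → Prop
  | left : InOrbit a b A C A
  | right : InOrbit a b A C C
  | fst {x : Q} : InOrbit a b A C x → InOrbit a b A C (a x)
  | snd {x : Q} : InOrbit a b A C x → InOrbit a b A C (b x)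

/-- An action of the braid group on three strands, with generators `a` and `b` of order `5`, and
two elements `A` and `C` that behave like the points `∞` and `0` of the projective line. -/
structure IsTwistAction {Q : Type*} (a b : Q → Q) (A C : Q) : Prop where
  braid : ∀ x, a (b (a x)) = b (a (b x))
  fst_five : ∀ x, a (a (a (a (a x)))) = x
  snd_five : ∀ x, b (b (b (b (b x)))) = x
  fst_left : a A = A
  snd_right : b C = C
  fst_snd_left : a (b A) = C
  snd_fst_right : b (a C) = A

/-- The orbit consists of the twelve elements `A`, `C`, `a C`, …, `b (b A)`, `a (b (b A))`, …, and
one more. They correspond to the vertices of the icosahedron. -/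
theorem IsTwistAction.table {Q : Type*} {a b : Q → Q} {A C : Q} (h : IsTwistAction a b A C)
    {v₁ v₂ v₃ v₄ u₀ u₁ u₂ u₃ u₄ A' : Q} (hv₁ : v₁ = a C) (hv₂ : v₂ = a v₁) (hv₃ : v₃ = a v₂)
    (hv₄ : v₄ = a v₃) (hu₄ : u₄ = b v₄) (hu₁ : u₁ = a u₄) (hu₃ : u₃ = a u₁) (hu₀ : u₀ = a u₃)
    (hu₂ : u₂ = a u₀) (hA' : A' = b u₂) :
    b A = v₄ ∧ b v₂ = v₃ ∧ b v₃ = u₂ ∧ b u₀ = u₀ ∧ b u₁ = v₁ ∧ b u₃ = v₂ ∧ b u₄ = u₁ ∧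
      b A' = u₃ ∧ a A' = A' ∧ a u₂ = u₄ ∧ a v₄ = C := by
  -- Model behind the names: vectors (x, y) mod 5 up to sign, with a(x, y) = (x + y, y) and b(x, y)
  -- = (x, y - x). Here A = (1, 0), C = (0, 1), vᵢ = (i, 1), uᵢ = (i, 2), A' = (2, 0). The instances
  -- below are a coset enumeration, closed by congruence.
  obtain ⟨braid, ha, hb, haA, hbC, hC, hA⟩ := h
  have := braid A
  have := braid C
  have := braid v₁
  have := braid v₂
  have := braid v₃
  have := braid v₄
  have := braid u₀
  have := braid u₁
  have := braid u₂
  have := braid u₃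
  have := braid u₄
  have := braid A'
  have := ha A
  have := ha C
  have := ha u₄
  have := ha A'
  have := ha (b A)
  have := ha (b v₃)
  have := ha u₂
  have := ha (b u₀)
  have := hb A
  have := hb C
  have := hb v₂
  have := hb u₀
  have := hb v₃
  have := hb u₃
  clear braid ha hb
  grind

/-- A function that is invariant under `b` takes at most four values on the orbit. -/
theorem IsTwistAction.four_values {Q R : Type*} {a b : Q → Q} {A C : Q}
    (h : IsTwistAction a b A C) {N : Q → R} (hN : ∀ x, N (b x) = N x) {x : Q}
    (hx : InOrbit a b A C x) :
    N x = N A ∨ N x = N C ∨ N x = N (a (a (a C))) ∨ N x = N (a (a (a (b (b A))))) := by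
  obtain ⟨t₁, t₂, t₃, t₄, t₅, t₆, t₇, t₈, t₉, t₁₀, t₁₁⟩ := h.table rfl rfl rfl rfl rfl rfl rfl rfl
    rfl rfl
  generalize hv₁ : a C = v₁ at *
  generalize hv₂ : a v₁ = v₂ at *
  generalize hv₃ : a v₂ = v₃ at *
  generalize hv₄ : a v₃ = v₄ at *
  generalize hu₄ : b v₄ = u₄ at *
  generalize hu₁ : a u₄ = u₁ at *
  generalize hu₃ : a u₁ = u₃ at *
  generalize hu₀ : a u₃ = u₀ at *
  generalize hu₂ : a u₀ = u₂ at *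
  generalize hA' : b u₂ = A' at *
  have hA : b v₁ = A := by rw [← hv₁]; exact h.snd_fst_right
  -- By the table the twelve elements are closed under both maps.
  have hmem : x = A ∨ x = C ∨ x = v₁ ∨ x = v₂ ∨ x = v₃ ∨ x = v₄ ∨ x = u₀ ∨ x = u₁ ∨ x = u₂ ∨
      x = u₃ ∨ x = u₄ ∨ x = A' := by
    have := h.fst_left
    have := h.snd_right
    induction hx with
    | left => simp
    | right => simp
    | fst _ ih => clear hN; grind (splits := 20)
    | snd _ ih => clear hN; grind (splits := 20)
  -- The cycles of `b` are (A v₄ u₄ u₁ v₁), (v₂ v₃ u₂ A' u₃) and the fixed points C and u₀; the four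
  -- listed values take one element from each.
  have e₁ := hN A
  have e₂ := hN v₁
  have e₃ := hN v₂
  have e₄ := hN v₃
  have e₅ := hN v₄
  have e₆ := hN u₁
  have e₇ := hN u₂
  have e₈ := hN u₃
  have e₉ := hN u₄
  have e₁₀ := hN A'
  clear hN hx h
  grind (splits := 20)

/-! ### Plats -/

/-- Tangle diagrams with four end points at the top, up to isotopy and `5`-moves. -/
def PlatClass : Type := Quot fun x y : {w : Word // IsTangle 0 w 4} => Step 0 4 x.1 y.1

/-- The class of a tangle diagram. -/
def PlatClass.mk (w : Word) (h : IsTangle 0 w 4) : PlatClass := Quot.mk _ ⟨w, h⟩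

theorem PlatClass.mk_eq {w w' : Word} (h : TangleEquiv 0 4 w w') (hw : IsTangle 0 w 4)
    (hw' : IsTangle 0 w' 4) : PlatClass.mk w hw = PlatClass.mk w' hw' := by
  induction h with
  | rel x y h => exact Quot.sound h
  | refl x => rfl
  | symm x y _ ih => exact (ih hw' hw).symm
  | trans x y z hxy _ ih ih₂ =>
    have hy := (isTangle_iff hxy).1 hw
    exact (ih hw hy).trans (ih₂ hy hw')

/-- Stack a tangle on top. -/
def PlatClass.stack (v : Word) (hv : IsTangle 4 v 4) : PlatClass → PlatClass :=
  Quot.lift (fun x => PlatClass.mk (x.1 ++ v) (x.2.append hv)) fun _ _ h =>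
    PlatClass.mk_eq (append_right (.rel _ _ h) hv) _ _

theorem PlatClass.stack_eq {v v' : Word} (h : TangleEquiv 4 4 v v') (hv : IsTangle 4 v 4)
    (hv' : IsTangle 4 v' 4) (x : PlatClass) : x.stack v hv = x.stack v' hv' := by
  induction x using Quot.ind with
  | mk x => exact PlatClass.mk_eq (append_left x.2 h) _ _

theorem PlatClass.stack_stack {v v' : Word} (hv : IsTangle 4 v 4) (hv' : IsTangle 4 v' 4)
    (x : PlatClass) : (x.stack v hv).stack v' hv' = x.stack (v ++ v') (hv.append hv') := by
  induction x using Quot.ind with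
  | mk x => exact PlatClass.mk_eq (by rw [List.append_assoc]; exact .refl _) _ _

theorem PlatClass.stack_nil (x : PlatClass) : x.stack [] rfl = x := by
  induction x using Quot.ind with
  | mk x => exact PlatClass.mk_eq (by rw [List.append_nil]; exact .refl _) _ _

theorem isTangle_inner (s : Bool) : IsTangle 4 [cross s 1] 4 := by
  simp [IsTangle, Piece.dom, Piece.cod]

theorem isTangle_outer (s : Bool) : IsTangle 4 [cross s 2] 4 := by
  simp [IsTangle, Piece.dom, Piece.cod]

theorem isTangle_turn : IsTangle 4 [cap 1, cup 1] 4 := by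
  simp [IsTangle, Piece.dom, Piece.cod]

theorem isTangle_nested : IsTangle 0 [cup 0, cup 1] 4 := by
  simp [IsTangle, Piece.dom, Piece.cod]

theorem isTangle_parallel : IsTangle 0 [cup 0, cup 2] 4 := by
  simp [IsTangle, Piece.dom, Piece.cod]

theorem isTangle_caps : IsTangle 4 [cap 0, cap 0] 0 := by
  simp [IsTangle, Piece.dom, Piece.cod]

/-- Add a crossing of the second and the third strand on top. -/
def PlatClass.inner (s : Bool) : PlatClass → PlatClass :=
  PlatClass.stack [cross s 1] (isTangle_inner s)

/-- Add a crossing of the third and the fourth strand on top. -/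
def PlatClass.outer (s : Bool) : PlatClass → PlatClass :=
  PlatClass.stack [cross s 2] (isTangle_outer s)

/-- Add a maximum and a minimum between the second and the third strand on top. -/
def PlatClass.turn : PlatClass → PlatClass :=
  PlatClass.stack [cap 1, cup 1] isTangle_turn

/-- Two nested minima. -/
def PlatClass.nested : PlatClass :=
  PlatClass.mk [cup 0, cup 1] isTangle_nested

/-- Two minima beside each other. -/
def PlatClass.parallel : PlatClass :=
  PlatClass.mk [cup 0, cup 2] isTangle_parallel

namespace PlatClass

theorem inner_inner_not (s : Bool) (x : PlatClass) : inner (!s) (inner s x) = x := by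
  rw [inner, inner, stack_stack,
    stack_eq (v' := []) (move 0 (.regular (.reidemeister_two s 1))) _ rfl, stack_nil]

theorem outer_outer_not (s : Bool) (x : PlatClass) : outer (!s) (outer s x) = x := by
  rw [outer, outer, stack_stack,
    stack_eq (v' := []) (move 0 (.regular (.reidemeister_two s 2))) _ rfl, stack_nil]

theorem inner_five (x : PlatClass) :
    inner true (inner true (inner true (inner true (inner true x)))) = x := by
  simp only [inner, stack_stack]
  rw [stack_eq (v' := []) (unmove 0 (.five true 1)) _ rfl, stack_nil]

theorem outer_five (x : PlatClass) :
    outer true (outer true (outer true (outer true (outer true x)))) = x := by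
  simp only [outer, stack_stack]
  rw [stack_eq (v' := []) (unmove 0 (.five true 2)) _ rfl, stack_nil]

/-- Modulo 5-moves the inverse twist is the fourth power, so positive crossings alone generate the
orbit. -/
theorem inner_false (x : PlatClass) :
    inner false x = inner true (inner true (inner true (inner true x))) := by
  conv_lhs => rw [← inner_five x]
  exact inner_inner_not true _

theorem outer_false (x : PlatClass) :
    outer false x = outer true (outer true (outer true (outer true x))) := by
  conv_lhs => rw [← outer_five x]
  exact outer_outer_not true _

theorem outer_nested (s : Bool) : outer s nested = inner (!s) parallel := by
  refine mk_eq ?_ _ _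
  have h : TangleEquiv 0 4 [cup 0, cup 2, cross (!s) 1] [cup 0, cup 1, cross (!!s) 2] :=
    move 1 (.regular (.slide_cup (!s) 1))
  rw [Bool.not_not] at h
  exact h.symm

/-- The braid relation is the third Reidemeister move, the fixed points are curls on a minimum, and
the two mixed relations come from sliding a strand across a leg of a minimum. -/
theorem isTwistAction : IsTwistAction (inner true) (outer true) nested parallel where
  braid x := by
    simp only [inner, outer, stack_stack]
    exact stack_eq (move 0 (.regular (.reidemeister_three true 1))) _ _ x
  fst_five := inner_five
  snd_five := outer_five
  fst_left := mk_eq (move 1 (.curl (.cup_true 1))) _ _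
  snd_right := mk_eq (move 1 (.curl (.cup_true 2))) _ _
  fst_snd_left := by
    rw [outer_nested]
    exact inner_inner_not false _
  snd_fst_right := by
    rw [show inner true parallel = outer false nested from (outer_nested false).symm]
    exact outer_outer_not false _

theorem turn_inner (x : PlatClass) : turn (inner true x) = turn x := by
  rw [turn, inner, stack_stack]
  exact stack_eq (move 0 (.curl (.cap_true 1))) _ _ x

/-- Close a plat on top by two maxima beside each other. -/
def close : PlatClass → Quot FiveMove :=
  Quot.lift (fun x => Quot.mk _ (LinkDiagram.toLink ⟨x.1 ++ [cap 0, cap 0],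
    x.2.append isTangle_caps⟩)) fun _ _ h =>
    Quot.eqvGen_sound (fiveMoveEquiv
      (append_right (.rel _ _ h) isTangle_caps) _ _)

/-- After the first maximum is moved below the crossing, the crossing is a curl under the second
one. -/
theorem close_outer (x : PlatClass) : close (outer true x) = close x := by
  induction x using Quot.ind with
  | mk x =>
    refine Quot.eqvGen_sound (fiveMoveEquiv ?_ _ _)
    rw [List.append_assoc]
    refine append_left x.2 ?_
    calc TangleEquiv 4 0 [cross true 2, cap 0, cap 0] [cap 0, cross true 0, cap 0] :=
          unmove 0 (.regular (.exchange .cap (.cross true) 0 0))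
      TangleEquiv 4 0 _ [cap 0, cap 0] := move 1 (.curl (.cap_true 0))

theorem close_nested : close nested = Quot.mk _ trivialKnot :=
  Quot.eqvGen_sound (fiveMoveEquiv
    (by exact move 1 (.regular (.zigzag_left 0))) _ _)

theorem close_parallel : close parallel = Quot.mk _ trivialLinkTwo :=
  Quot.eqvGen_sound (fiveMoveEquiv
    (by exact unmove 1 (.regular (.exchange .cap .cup 0 0))) _ _)

/-- Three half-twists equal minus two modulo 5, which gives the clasp of the Hopf link. -/
theorem close_hopf :
    close (inner true (inner true (inner true parallel))) = Quot.mk _ hopfLink := by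
  have h : inner true (inner true (inner true parallel)) = inner false (inner false parallel) := by
    rw [inner_false, inner_false, inner_five]
  rw [h]
  exact Quot.eqvGen_sound (fiveMoveEquiv hopf_plat.symm _ _)

theorem close_figureEight :
    close (inner true (inner true (inner true (outer true (outer true nested))))) =
      Quot.mk _ figureEightKnot := by
  have h : ∀ x, inner true (inner true (inner true x)) = inner false (inner false x) := by
    intro x
    rw [inner_false, inner_false, inner_five]
  rw [h]
  exact Quot.eqvGen_sound (fiveMoveEquiv figureEight_plat.symm _ _)

end PlatClass

open PlatClass

theorem inOrbit_inner {x : PlatClass} (s : Bool)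
    (hx : InOrbit (inner true) (outer true) nested parallel x) :
    InOrbit (inner true) (outer true) nested parallel (inner s x) := by
  cases s with
  | true => exact hx.fst
  | false => rw [inner_false]; exact hx.fst.fst.fst.fst

theorem inOrbit_outer {x : PlatClass} (s : Bool)
    (hx : InOrbit (inner true) (outer true) nested parallel x) :
    InOrbit (inner true) (outer true) nested parallel (outer s x) := by
  cases s with
  | true => exact hx.snd
  | false => rw [outer_false]; exact hx.snd.snd.snd.snd

/-- A rational tangle whose lower end points are bent up lies in the orbit. -/
theorem IsRationalTangle.inOrbit {T : Word} (hT : IsRationalTangle T)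
    (h : IsTangle 0 ([cup 0, cup 1] ++ T) 4) :
    InOrbit (inner true) (outer true) nested parallel (PlatClass.mk ([cup 0, cup 1] ++ T) h) := by
  induction hT with
  | zero =>
    have e : PlatClass.mk ([cup 0, cup 1] ++ [cap 0, cup 0]) h = parallel := by
      refine mk_eq ?_ _ _
      calc TangleEquiv 0 4 [cup 0, cup 1, cap 0, cup 0] [cup 0, cup 0] :=
            move 1 (.regular (.zigzag_left 0))
        TangleEquiv 0 4 _ [cup 0, cup 2] := unmove 0 (.regular (.exchange .cup .cup 0 0))
    rw [e]
    exact .right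
  | infty => exact .left
  | @right T s hT ih =>
    have hT' : IsTangle 0 ([cup 0, cup 1] ++ T) 4 :=
      isTangle_nested.append
        (hT.isTangle.add_right 2)
    have e : PlatClass.mk _ h = inner (!s) (PlatClass.mk _ hT') :=
      mk_eq (bend_right s hT.isTangle) _ _
    rw [e]
    exact inOrbit_inner _ (ih hT')
  | @bottom T s hT ih =>
    have hT' : IsTangle 0 ([cup 0, cup 1] ++ T) 4 :=
      isTangle_nested.append
        (hT.isTangle.add_right 2)
    have e : PlatClass.mk _ h = outer s (PlatClass.mk _ hT') :=
      mk_eq (bend_bottom s hT.isTangle) _ _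
    rw [e]
    exact inOrbit_outer _ (ih hT')

theorem IsRationalLink.exists_fiveMoveEquiv {L : Link} (hL : IsRationalLink L) :
    ∃ i : Fin 4, FiveMoveEquiv L
      (![trivialKnot, trivialLinkTwo, hopfLink, figureEightKnot] i) := by
  obtain ⟨T, ⟨w, hw⟩, hT, rfl, rfl⟩ := hL
  have hT' : IsTangle 0 ([cup 0, cup 1] ++ T) 4 :=
    isTangle_nested.append (hT.isTangle.add_right 2)
  have e : Quot.mk FiveMove (LinkDiagram.toLink ⟨numerator T, hw⟩) =
      close (PlatClass.mk _ hT') :=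
    Quot.eqvGen_sound (fiveMoveEquiv (bend_numerator hT.isTangle) _ _)
  rcases isTwistAction.four_values close_outer (hT.inOrbit hT') with h | h | h | h <;>
    rw [← e] at h
  · exact ⟨0, Quot.eqvGen_exact (h.trans close_nested)⟩
  · exact ⟨1, Quot.eqvGen_exact (h.trans close_parallel)⟩
  · exact ⟨2, Quot.eqvGen_exact (h.trans close_hopf)⟩
  · exact ⟨3, Quot.eqvGen_exact (h.trans close_figureEight)⟩

/-! ### Kauffman values and `5`-moves -/

namespace IsKauffmanValueAtOne

variable {x : ℝ} {F : Link → ℝ}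

theorem skein_toLink (hF : IsKauffmanValueAtOne x F) (s : Bool) {u v : Word} {l : ℕ}
    (h : ∀ s, IsTangle 0 (u ++ [cross s l] ++ v) 0) (h₀ : IsTangle 0 (u ++ v) 0)
    (h₁ : IsTangle 0 (u ++ [cap l, cup l] ++ v) 0) :
    F (LinkDiagram.toLink ⟨_, h s⟩) + F (LinkDiagram.toLink ⟨_, h !s⟩) =
      x * (F (LinkDiagram.toLink ⟨_, h₀⟩) + F (LinkDiagram.toLink ⟨_, h₁⟩)) := by
  have := IsKauffman.skein hF u v l ⟨_, h true⟩ ⟨_, h false⟩ ⟨_, h₀⟩ ⟨_, h₁⟩ rfl rfl rfl rfl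
  cases s with
  | true => exact this
  | false => rw [add_comm]; exact this

end IsKauffmanValueAtOne

theorem isTangle_replicate_cross (s : Bool) {l m : ℕ} (hl : l + 2 ≤ m) (k : ℕ) :
    IsTangle m (List.replicate k (cross s l)) m := by
  induction k with
  | zero => rfl
  | succ k ih =>
    refine ⟨hl, ?_⟩
    rwa [show m - (cross s l).piece.dom + (cross s l).piece.cod = m from Nat.sub_add_cancel (by
      simp only [Piece.dom]; omega)]

theorem isTangle_turn_back {l m : ℕ} (hl : l + 2 ≤ m) : IsTangle m [cap l, cup l] m := by
  simp only [IsTangle, Piece.dom, Piece.cod]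
  omega

theorem two_mul_cos_sq :
    (2 * Real.cos (2 * Real.pi / 5)) ^ 2 + 2 * Real.cos (2 * Real.pi / 5) - 1 = 0 := by
  rw [two_mul_cos_two_pi_div_five]
  have h5 : √5 ^ 2 = 5 := Real.sq_sqrt (by norm_num)
  linear_combination h5 / 4

/-- The characteristic polynomial λ² - xλ + 1 has primitive fifth roots of unity as roots exactly
when x² + x - 1 = 0. Hence a solution is a constant plus a sequence of period five. -/
theorem eq_of_five_skein {x : ℝ} (hx : x ^ 2 + x - 1 = 0) {g : ℕ → ℝ} {c : ℝ}
    (hg : ∀ k, g (k + 2) + g k = x * (g (k + 1) + c)) : g 5 = g 0 := by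
  have h₀ := hg 0
  have h₁ := hg 1
  have h₂ := hg 2
  have h₃ := hg 3
  norm_num at h₀ h₁ h₂ h₃
  linear_combination h₃ + x * h₂ + (x ^ 2 - 1) * h₁ + (x ^ 3 - 2 * x) * h₀ +
    ((x ^ 2 - x - 1) * g 1 - (x - 1) * g 0 + x ^ 2 * c) * hx

theorem IsKauffmanValueAtOne.fiveMove {x : ℝ} {F : Link → ℝ} (hF : IsKauffmanValueAtOne x F)
    (hx : x ^ 2 + x - 1 = 0) {L L' : Link} (h : FiveMove L L') : F L = F L' := by
  obtain ⟨⟨w, hw⟩, ⟨w', hw'⟩, s, l, rfl, rfl, u, v, h₁, h₂⟩ := h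
  simp only [List.append_nil] at h₁ h₂
  subst h₁ h₂
  obtain ⟨m, hu, hm⟩ := isTangle_append.1 (by simpa only [List.append_assoc] using hw')
  have hl : l + 2 ≤ m := hm.1
  obtain ⟨m', hm₁, hv⟩ := isTangle_append.1 hm
  have hmm : ∀ {w : Word} {a b c : ℕ}, IsTangle a w b → IsTangle a w c → b = c := by
    intro w
    induction w with
    | nil => intro a b c h h'; exact h.symm.trans h'
    | cons t w ih => intro a b c h h'; exact ih h.2 h'.2
  obtain rfl : m' = m := hmm hm₁ (isTangle_replicate_cross s hl 5)
  clear hm hm₁ hmm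
  have hr : ∀ k, IsTangle 0 (u ++ List.replicate k (cross s l)) m' := fun k =>
    hu.append (isTangle_replicate_cross s hl k)
  have hc : ∀ s, IsTangle m' [cross s l] m' := fun s => isTangle_replicate_cross s hl 1
  have ht := isTangle_turn_back hl
  -- Under a maximum the `k` half-twists are `k` curls, which are free at `a = 1`; so the last term
  -- of the recurrence does not depend on `k`.
  have hturn : ∀ k,
      F (LinkDiagram.toLink ⟨u ++ List.replicate k (cross s l) ++ [cap l, cup l] ++ v,
        ((hr k).append ht).append hv⟩) =
      F (LinkDiagram.toLink ⟨u ++ [cap l, cup l] ++ v, (hu.append ht).append hv⟩) := by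
    intro k
    induction k with
    | zero => simp
    | succ k ih =>
      rw [← ih]
      congr 1
      have hcurl : ∃ e, CurlMove e [cross s l, cap l] [cap l] := by
        cases s
        · exact ⟨1, .cap_false l⟩
        · exact ⟨-1, .cap_true l⟩
      refine toLink_eq_of_isotopy (r := [cross s l, cap l]) (r' := [cap l])
        ⟨u ++ List.replicate k (cross s l), [cup l] ++ v, ?_, ?_⟩ (.inr hcurl)
      · simp [List.replicate_succ']
      · simp
  have key := eq_of_five_skein hx (g := fun k => F (LinkDiagram.toLink
    ⟨u ++ List.replicate k (cross s l) ++ v, (hr k).append hv⟩))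
    (c := F (LinkDiagram.toLink ⟨u ++ [cap l, cup l] ++ v, (hu.append ht).append hv⟩))
    (fun k => ?_)
  · have e : u ++ List.replicate 0 (cross s l) ++ v = u ++ v := by simp
    simp only [e] at key
    exact key.symm
  · have h := hF.skein_toLink s
      (fun s => ((hr (k + 1)).append (hc s)).append hv) ((hr (k + 1)).append hv)
      (((hr (k + 1)).append ht).append hv)
    rw [hturn] at h
    rw [← h]
    congr 2
    · congr 2
      simp [List.replicate_succ']
    · refine (toLink_eq_of_isotopy (r := [cross s l, cross (!s) l]) (r' := [])
        ⟨u ++ List.replicate k (cross s l), v, ?_, ?_⟩ (.inl (.reidemeister_two s l))).symm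
      · simp [List.replicate_succ']
      · simp

/-- The value of an invariant of `5`-move equivalence on plats. -/
def platValue {F : Link → ℝ} (h : ∀ L L', FiveMove L L' → F L = F L') (p : PlatClass) : ℝ :=
  Quot.lift F h p.close

theorem platValue_skein {x : ℝ} {F : Link → ℝ} (hF : IsKauffmanValueAtOne x F)
    (h : ∀ L L', FiveMove L L' → F L = F L') (p : PlatClass) :
    platValue h (inner true p) + platValue h (inner false p) =
      x * (platValue h p + platValue h (turn p)) := by
  induction p using Quot.ind with
  | mk p =>
    exact hF.skein_toLink true (l := 1)
      (fun s => (p.2.append (isTangle_inner s)).append isTangle_caps) (p.2.append isTangle_caps)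
      ((p.2.append isTangle_turn).append isTangle_caps)

theorem IsKauffmanValueAtOne.trivialKnot {x : ℝ} {F : Link → ℝ} (hF : IsKauffmanValueAtOne x F) :
    F trivialKnot = 1 :=
  IsKauffman.circle hF

/-- The skein rule at a single curl on the circle: both crossings give the trivial knot, and the
smoothings give one and two circles. -/
theorem IsKauffmanValueAtOne.trivialLinkTwo {x : ℝ} {F : Link → ℝ}
    (hF : IsKauffmanValueAtOne x F) : x * (1 + F trivialLinkTwo) = 2 := by
  have hc : ∀ s, IsTangle 0 [cup 0, cross s 0, cap 0] 0 := by
    simp [IsTangle, Piece.dom, Piece.cod]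
  have h := hF.skein_toLink true (u := [cup 0]) (v := [cap 0]) (l := 0) hc
    (by simp [IsTangle, Piece.dom, Piece.cod]) (by simp [IsTangle, Piece.dom, Piece.cod])
  have e₁ : LinkDiagram.toLink ⟨_, hc true⟩ = KnotDiagram.trivialKnot :=
    toLink_eq_of_isotopy ⟨[], [cap 0], rfl, rfl⟩ (.inr ⟨_, .cup_true 0⟩)
  have e₂ : LinkDiagram.toLink ⟨_, hc false⟩ = KnotDiagram.trivialKnot :=
    toLink_eq_of_isotopy ⟨[], [cap 0], rfl, rfl⟩ (.inr ⟨_, .cup_false 0⟩)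
  have h' : F KnotDiagram.trivialKnot + F KnotDiagram.trivialKnot =
      x * (F KnotDiagram.trivialKnot + F KnotDiagram.trivialLinkTwo) := by
    conv_lhs => rw [← e₂]
    nth_rewrite 1 [e₂, ← e₁]
    exact h
  rw [hF.trivialKnot] at h'
  linarith

theorem sqrt_five_bounds : 2 < √5 ∧ √5 ^ 2 = 5 := by
  refine ⟨?_, Real.sq_sqrt (by norm_num)⟩
  rw [Real.lt_sqrt (by norm_num)]
  norm_num

/-- The values on the four basic links. -/
theorem IsKauffmanValueAtOne.values {F : Link → ℝ}
    (hF : IsKauffmanValueAtOne (2 * Real.cos (2 * Real.pi / 5)) F) :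
    F KnotDiagram.trivialKnot = 1 ∧ F KnotDiagram.trivialLinkTwo = √5 ∧ F hopfLink = -1 ∧
      F figureEightKnot = -√5 := by
  obtain ⟨h2, h5⟩ := sqrt_five_bounds
  have hfive : ∀ L L', FiveMove L L' → F L = F L' := fun _ _ => hF.fiveMove two_mul_cos_sq
  have hO : F KnotDiagram.trivialKnot = 1 := hF.trivialKnot
  have hT := hF.trivialLinkTwo
  have skein := platValue_skein hF hfive
  rw [two_mul_cos_two_pi_div_five] at hT skein
  have hT : F KnotDiagram.trivialLinkTwo = √5 := by
    have : √5 - 1 ≠ 0 := by linarith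
    apply mul_left_cancel₀ this
    linear_combination 2 * hT - h5
  have hN : ∀ p, platValue hfive (outer true p) = platValue hfive p := fun p => by
    rw [platValue, close_outer, platValue]
  have vA : platValue hfive nested = 1 := by rw [platValue, close_nested]; exact hO
  have vC : platValue hfive parallel = √5 := by rw [platValue, close_parallel]; exact hT
  have vH : platValue hfive (inner true (inner true (inner true parallel))) = F hopfLink := by
    rw [platValue, close_hopf]
  have vE : platValue hfive (inner true (inner true (inner true (outer true (outer true nested)))))
      = F figureEightKnot := by
    rw [platValue, close_figureEight]
  have hA : outer true (inner true parallel) = nested := isTwistAction.snd_fst_right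
  -- The skein rule at `inner true p`: the negative crossing cancels, and the turn-back absorbs the
  -- positive one.
  have skein' : ∀ p, platValue hfive (inner true (inner true p)) + platValue hfive p =
      (√5 - 1) / 2 * (platValue hfive (inner true p) + platValue hfive (turn p)) := fun p => by
    rw [← turn_inner p, ← skein]
    congr 2
    exact (inner_inner_not true p).symm
  obtain ⟨v₁, hv₁⟩ : ∃ v, v = inner true parallel := ⟨_, rfl⟩
  obtain ⟨v₂, hv₂⟩ : ∃ v, v = inner true v₁ := ⟨_, rfl⟩
  obtain ⟨v₃, hv₃⟩ : ∃ v, v = inner true v₂ := ⟨_, rfl⟩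
  obtain ⟨v₄, hv₄⟩ : ∃ v, v = inner true v₃ := ⟨_, rfl⟩
  obtain ⟨u₄, hu₄⟩ : ∃ v, v = outer true v₄ := ⟨_, rfl⟩
  obtain ⟨u₁, hu₁⟩ : ∃ v, v = inner true u₄ := ⟨_, rfl⟩
  obtain ⟨u₃, hu₃⟩ : ∃ v, v = inner true u₁ := ⟨_, rfl⟩
  obtain ⟨u₀, hu₀⟩ : ∃ v, v = inner true u₃ := ⟨_, rfl⟩
  obtain ⟨u₂, hu₂⟩ : ∃ v, v = inner true u₀ := ⟨_, rfl⟩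
  obtain ⟨t₁, t₂, t₃, -, -, -, t₇, -, -, t₁₀, t₁₁⟩ :=
    isTwistAction.table hv₁ hv₂ hv₃ hv₄ hu₄ hu₁ hu₃ hu₀ hu₂ rfl
  rw [← hv₁, ← hv₂, ← hv₃] at vH
  rw [t₁, ← hu₄, ← hu₁, ← hu₃, ← hu₀] at vE
  rw [← hv₁] at hA
  have w₁ : platValue hfive v₁ = 1 := by rw [← hN, hA, vA]
  have w₄ : platValue hfive v₄ = 1 := by rw [← t₁, hN, vA]
  have w₃ : platValue hfive v₃ = platValue hfive v₂ := by rw [← t₂, hN]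
  have y₄ : platValue hfive u₄ = 1 := by rw [hu₄, hN, w₄]
  have y₁ : platValue hfive u₁ = 1 := by rw [← t₇, hN, y₄]
  have y₂ : platValue hfive u₂ = platValue hfive v₂ := by rw [← t₃, hN, w₃]
  -- Besides the Hopf value at `v₂` and the figure-eight value at `u₀`, the unknowns are the
  -- turn-backs of `parallel` and `u₂`. Invariance under `outer` and `turn_inner` reduce all other
  -- terms to these and known values. So `k₂` gives the first turn-back and `k₁` the Hopf value;
  -- then `k₃` gives the second turn-back and `k₄` the figure-eight value.
  have k₁ := skein' parallel
  have k₂ := skein' v₄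
  have k₃ := skein' u₂
  have k₄ := skein' u₀
  rw [← hv₁, ← hv₂, vC, w₁] at k₁
  rw [t₁₁, ← hv₁, vC, w₁, w₄, ← turn_inner v₄, t₁₁] at k₂
  rw [t₁₀, ← hu₁, y₁, y₂, y₄] at k₃
  rw [← hu₂, t₁₀, y₄, y₂, ← turn_inner u₀, ← hu₂] at k₄
  have hne : (√5 - 1) / 2 ≠ 0 := by linarith
  have e₁ : platValue hfive parallel.turn = 1 := by
    apply mul_left_cancel₀ hne
    linear_combination -k₂ - h5 / 2
  have hH : platValue hfive v₂ = -1 := by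
    rw [e₁] at k₁
    linear_combination k₁
  have e₂ : platValue hfive u₂.turn = -1 := by
    apply mul_left_cancel₀ hne
    linear_combination -k₃ + hH
  refine ⟨hO, hT, ?_, ?_⟩
  · rw [← vH, w₃, hH]
  · rw [← vE]
    rw [e₂, hH] at k₄
    linear_combination k₄

theorem IsKauffmanValueAtOne.fiveMoveEquiv {F : Link → ℝ}
    (hF : IsKauffmanValueAtOne (2 * Real.cos (2 * Real.pi / 5)) F) {L L' : Link}
    (h : FiveMoveEquiv L L') : F L = F L' := by
  induction h with
  | rel _ _ h => exact hF.fiveMove two_mul_cos_sq h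
  | refl _ => rfl
  | symm _ _ _ ih => exact ih.symm
  | trans _ _ _ _ _ ih ih₂ => exact ih.trans ih₂

/-- The values distinguish the four basic links. -/
theorem IsKauffmanValueAtOne.basic_injective {F : Link → ℝ}
    (hF : IsKauffmanValueAtOne (2 * Real.cos (2 * Real.pi / 5)) F) {i j : Fin 4}
    (h : F (![KnotDiagram.trivialKnot, KnotDiagram.trivialLinkTwo, hopfLink, figureEightKnot] i) =
      F (![KnotDiagram.trivialKnot, KnotDiagram.trivialLinkTwo, hopfLink, figureEightKnot] j)) :
    i = j := by
  obtain ⟨h₀, h₁, h₂, h₃⟩ := hF.values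
  obtain ⟨h2, -⟩ := sqrt_five_bounds
  fin_cases i <;> fin_cases j <;> first
    | rfl
    | (exfalso
       simp [h₀, h₁, h₂, h₃] at h
       try linarith)

end KnotDiagram

theorem theorem2p9 :
    (∀ L : KnotDiagram.Link, KnotDiagram.IsRationalLink L →
      ∃! i : Fin 4, KnotDiagram.FiveMoveEquiv L
        (![KnotDiagram.trivialKnot, KnotDiagram.trivialLinkTwo, KnotDiagram.hopfLink,
          KnotDiagram.figureEightKnot] i)) ∧
    (∃ F : KnotDiagram.Link → ℝ,
      KnotDiagram.IsKauffmanValueAtOne (2 * Real.cos (2 * Real.pi / 5)) F) ∧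
    ∀ F : KnotDiagram.Link → ℝ,
      KnotDiagram.IsKauffmanValueAtOne (2 * Real.cos (2 * Real.pi / 5)) F →
      (∀ L L' : KnotDiagram.Link, KnotDiagram.IsRationalLink L → KnotDiagram.IsRationalLink L' →
        (KnotDiagram.FiveMoveEquiv L L' ↔ F L = F L')) ∧
      F KnotDiagram.trivialKnot = 1 ∧ F KnotDiagram.trivialLinkTwo = √5 ∧
      F KnotDiagram.hopfLink = -1 ∧ F KnotDiagram.figureEightKnot = -√5 := by
  refine ⟨fun L hL => ?_, ⟨_, KnotDiagram.gaussInvariant_isKauffmanValueAtOne⟩, fun F hF =>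
    ⟨fun L L' hL hL' => ⟨hF.fiveMoveEquiv, fun h => ?_⟩, hF.values⟩⟩
  · obtain ⟨i, hi⟩ := hL.exists_fiveMoveEquiv
    refine ⟨i, hi, fun j hj => ?_⟩
    have hF := KnotDiagram.gaussInvariant_isKauffmanValueAtOne
    exact hF.basic_injective (hF.fiveMoveEquiv (.trans _ _ _ (.symm _ _ hj) hi))
  · obtain ⟨i, hi⟩ := hL.exists_fiveMoveEquiv
    obtain ⟨j, hj⟩ := hL'.exists_fiveMoveEquiv
    obtain rfl : i = j := hF.basic_injective
      ((hF.fiveMoveEquiv hi).symm.trans (h.trans (hF.fiveMoveEquiv hj)))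
    exact .trans _ _ _ hi (.symm _ _ hj)
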